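/- **Setting.** Fix an integer $q\ge 1$. For every $n$ observe $X_t=f_t+Z_t$, $t=1,\dots,n$, with $f_t=f_0+\sum_{j=1}^q f'_j\,\mathbb I(t\ge\theta_j+1)$, where $0=\theta_0<\theta_1<\dots<\theta_q<\theta_{q+1}=n$ are integers and $f'_j\ne 0$ (for all large $n$). The quantities $f_0,\theta_j,f'_j$ and the noise $Z_t$ may depend on $n$. Put $\delta_j=\min(\theta_j-\theta_{j-1},\theta_{j+1}-\theta_j)$ and, for $\ell<b<r$, $$\mathcal X_{\ell,b,r}=\sqrt{\tfrac{(b-\ell)(r-b)}{r-\ell}}\Big(\tfrac1{b-\ell}\sum_{t=\ell+1}^bX_t-\tfrac1{r-b}\sum_{t=b+1}^rX_t\Big).$$ **WBS2.** Given $R_n\in\mathbb N$, the algorithm on $(s,e]$ returns nothing if $e-s\le1$. Otherwise let $\mathcal A_{s,e}=\{(\ell,r)\in\mathbb Z^2: s\le\ell<r\le e,\ r-\ell>1\}$. If $|\mathcal A_{s,e}|\le R_n$ let $\mathcal R_{s,e}=\mathcal A_{s,e}$; otherwise let $K$ be the smallest integer with $K(K-1)/2\ge R_n$ and let $\mathcal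 R_{s,e}$ consist of the $(\ell,r)\in\mathcal A_{s,e}$ whose end points both lie on the grid of the points $\frac{e-s}{K-1}(k-1)+s$, $k=1,\dots,K$, rounded to the nearest integer. Take a maximiser $(s_\circ,b_\circ,e_\circ)$ of $|\mathcal X_{\ell,b,r}|$ over $(\ell,r)\in\mathcal R_{s,e}$, $\ell<b<r$, record it, and continue on $(s,b_\circ]$ and $(b_\circ,e]$. The algorithm is started on $(0,n]$. Order the recorded triples with $|\mathcal X_{\ell,b,r}|>0$ by decreasing $|\mathcal X_{\ell,b,r}|$, and let $\hat\theta_1<\dots<\hat\theta_q$ be the split points $b$ of the first $q$ of them. **Refinement.** Let $\ell_1=0$, $r_q=n$, $\ell_j=\lfloor\frac23\hat\theta_{j-1}+\frac13\hat\theta_j\rfloor$ for $2\le j\le q$, $r_j=\lfloor\frac13\hat\theta_j+\frac23\hat\theta_{j+1}\rfloor$ for $1\le j\le q-1$, and let $\check\theta_j$ be a maximiser of $|\mathcal X_{\ell_j,b,r_j}|$ over $\ell_j<b<r_j$. **Assumptions.** 1. $\mathbb E Z_t=0$ and $\operatorname{Var}Z_t=\sigma_Z^2$ with a fixed $\sigma_Z\in(0,\infty)$;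 $\sqrt{\log n}=O(\zeta_n)$ and $\zeta_n=O(\log^\kappa n)$ for some $\kappa\ge\frac12$; and $\mathsf P(\mathcal Z_n)\to1$, where $\mathcal Z_n=\{\max_{0\le s<e\le n}(e-s)^{-1/2}|\sum_{t=s+1}^eZ_t|\le\zeta_n\}$. 2. $\max_j|f'_j|=O(1)$; for some $c_1\in(0,1)$, $\min_j\delta_j\ge c_1n$ for all large $n$; and for some $\varphi>0$, $\zeta_n^2/\min_j\big((f'_j)^2\delta_j\big)=O(n^{-\varphi})$. 3. For all large $n$, $R_n\ge\frac98(n/\min_j\delta_j)^2+1$; and there are integers $Q_n$ with $Q_n>q$ for all large $n$ and $Q_n\log^2(\zeta_n)/\log^2(n)\to0$. 4. $\tilde\zeta_n=O(\zeta_n)$ and $\tilde\zeta_n$ is bounded away from zero for all large $n$. For every sequence $(a_n)$ that is admissible, i.e. $1\le a_n\le\min_j(f'_j)^2\delta_j$ for all large $n$, $\mathsf P(\tilde{\mathcal Z}_n(a_n))\to1$. Here $\tilde{\mathcal Z}_n(a)$ is the event that, for every $1\le j\le q$, $$\frac{\sqrt{(f'_j)^{-2}a}}{k}\Big|\sum_{t=\theta_j-k+1}^{\theta_j}Z_t\Big|\le\tilde\zeta_n\quad\text{for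 all integers }k\text{ with }(f'_j)^{-2}a\le k\le\theta_j-\theta_{j-1},$$ $$\frac{\sqrt{(f'_j)^{-2}a}}{k}\Big|\sum_{t=\theta_j+1}^{\theta_j+k}Z_t\Big|\le\tilde\zeta_n\quad\text{for all integers }k\text{ with }(f'_j)^{-2}a\le k\le\theta_{j+1}-\theta_j.$$ **Conclusion.** There is $c_3\in(0,\infty)$, not depending on $n$, such that the sequence $a_n=c_3\tilde\zeta_n^2$ is admissible and, with $\tilde{\mathcal Z}_n=\tilde{\mathcal Z}_n(c_3\tilde\zeta_n^2)$, for all large $n$, $$\mathsf P\Big(\max_{1\le j\le q}(f'_j)^2|\check\theta_j-\theta_j|\le c_3\tilde\zeta_n^2\Big)\ \ge\ \mathsf P(\mathcal Z_n\cap\tilde{\mathcal Z}_n),\qquad \mathsf P(\mathcal Z_n\cap\tilde{\mathcal Z}_n)\to1 .$$ The event on the left includes that the estimates exist, and the bound is meant for every way of breaking ties between maximisers. -/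

import Mathlib

open Filter Topology MeasureTheory ProbabilityTheory Asymptotics

noncomputable section

namespace WBS

/-! ### The change point model -/

/-- `0 = θ₀ < θ₁ < ⋯ < θ_q < θ_{q+1} = n` are change points with jump sizes `f'₁, …, f'_q`.
Only the indices `0, …, q + 1` of `θ` and `1, …, q` of `f'` are meaningful. -/
structure IsChangePointModel (q n : ℕ) (θ : ℕ → ℕ) (f' : ℕ → ℝ) : Prop where
  first : θ 0 = 0
  last : θ (q + 1) = n
  lt : ∀ j ∈ Finset.range (q + 1), θ j < θ (j + 1)
  jump_ne : ∀ j ∈ Finset.Icc 1 q, f' j ≠ 0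

/-- The piecewise constant signal `f_t = f₀ + ∑ⱼ f'ⱼ 𝟙(t ≥ θⱼ + 1)`. -/
def signal (q : ℕ) (θ : ℕ → ℕ) (f' : ℕ → ℝ) (f₀ : ℝ) (t : ℕ) : ℝ :=
  f₀ + ∑ j ∈ Finset.Icc 1 q, if θ j + 1 ≤ t then f' j else 0

/-- `δⱼ = min(θⱼ - θ_{j-1}, θ_{j+1} - θⱼ)`, for `1 ≤ j ≤ q`. -/
def spacing (θ : ℕ → ℕ) (j : ℕ) : ℝ :=
  min ((θ j : ℝ) - θ (j - 1)) ((θ (j + 1) : ℝ) - θ j)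

/-! ### CUSUM statistics and the WBS2 algorithm -/

/-- The CUSUM statistic of `x` over `(l, r]` at the split point `b`, `l < b < r`. -/
def cusum (x : ℕ → ℝ) (l b r : ℕ) : ℝ :=
  Real.sqrt (((b : ℝ) - l) * ((r : ℝ) - b) / ((r : ℝ) - l)) *
    (1 / ((b : ℝ) - l) * ∑ t ∈ Finset.Ioc l b, x t
      - 1 / ((r : ℝ) - b) * ∑ t ∈ Finset.Ioc b r, x t)

/-- All pairs `(l, r)` with `s ≤ l < r ≤ e` and `r - l > 1`. -/
def allIntervals (s e : ℕ) : Finset (ℕ × ℕ) :=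
  (Finset.Icc s e ×ˢ Finset.Icc s e).filter fun p => p.1 + 1 < p.2

/-- The smallest `K` such that at least `R` intervals have their end points in `{1, …, K}`. -/
def gridSize (R : ℕ) : ℕ := sInf {K : ℕ | R ≤ K.choose 2}

/-- The integer grid `{1, …, K}` mapped linearly, with rounding, into `[s, e]`:
`j ↦ [(e - s) / (K - 1) * j + s - (e - s) / (K - 1)]`. -/
def grid (K s e : ℕ) : Finset ℕ :=
  (Finset.Icc 1 K).image fun j : ℕ =>
    (round (((e : ℚ) - s) / ((K : ℚ) - 1) * (j : ℚ) + s - ((e : ℚ) - s) / ((K : ℚ) - 1))).toNat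

/-- The intervals examined on `(s, e]`: all of them if there are at most `R`, otherwise those with
both end points on the equispaced grid (deterministic sampling). -/
def sampledIntervals (R s e : ℕ) : Finset (ℕ × ℕ) :=
  if (allIntervals s e).card ≤ R then allIntervals s e
  else (allIntervals s e).filter fun p =>
    p.1 ∈ grid (gridSize R) s e ∧ p.2 ∈ grid (gridSize R) s e

/-- `(l, b, r)` attains the maximum of the absolute CUSUM over the examined intervals and
their interior points. -/
def IsMaxEnergySplit (x : ℕ → ℝ) (R s e l b r : ℕ) : Prop :=
  ((l, r) ∈ sampledIntervals R s e ∧ l < b ∧ b < r) ∧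
    ∀ l' b' r' : ℕ, (l', r') ∈ sampledIntervals R s e → l' < b' → b' < r' →
      |cusum x l' b' r'| ≤ |cusum x l b r|

/-- `IsWBS2 x R s e P`: the set `P` of triples `(l, b, r)` is an output of the WBS2 recursion run
on the data `x` over `(s, e]`, with ties between maximisers broken arbitrarily. -/
inductive IsWBS2 (x : ℕ → ℝ) (R : ℕ) : ℕ → ℕ → Finset (ℕ × ℕ × ℕ) → Prop
  | base (s e : ℕ) (h : e ≤ s + 1) : IsWBS2 x R s e ∅
  | split (s e l b r : ℕ) (P₁ P₂ : Finset (ℕ × ℕ × ℕ)) (h : s + 1 < e)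
      (hmax : IsMaxEnergySplit x R s e l b r)
      (h₁ : IsWBS2 x R s b P₁) (h₂ : IsWBS2 x R b e P₂) :
      IsWBS2 x R s e (insert (l, b, r) (P₁ ∪ P₂))

/-- The max-CUSUM attached to a triple `(l, b, r)`. -/
def maxCusum (x : ℕ → ℝ) (p : ℕ × ℕ × ℕ) : ℝ := |cusum x p.1 p.2.1 p.2.2|

/-- `path` lists the entries of `P₀` with a non-zero max-CUSUM, each once, in decreasing order of
their max-CUSUMs. -/
def IsSolutionPath (x : ℕ → ℝ) (P₀ : Finset (ℕ × ℕ × ℕ)) (path : List (ℕ × ℕ × ℕ)) : Prop :=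
  path.Nodup ∧ (∀ p, p ∈ path ↔ p ∈ P₀ ∧ 0 < maxCusum x p) ∧
    path.Pairwise fun p p' => maxCusum x p' ≤ maxCusum x p

/-- `θhat 1 < ⋯ < θhat q` are the `q` split points belonging to the `q` largest max-CUSUMs
(in particular the path has at least `q` entries). -/
def IsTopEstimate (q : ℕ) (path : List (ℕ × ℕ × ℕ)) (θhat : ℕ → ℕ) : Prop :=
  q ≤ path.length ∧ StrictMonoOn θhat (Set.Icc 1 q) ∧
    (Finset.Icc 1 q).image θhat = ((path.take q).map fun p => p.2.1).toFinset

/-! ### The refinement step -/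

/-- `ℓ₁ = 0` and `ℓⱼ = ⌊(2/3) θhat_{j-1} + (1/3) θhat_j⌋` for `2 ≤ j ≤ q`
(division in `ℕ` rounds down). -/
def refineLeft (θhat : ℕ → ℕ) (j : ℕ) : ℕ :=
  if j = 1 then 0 else (2 * θhat (j - 1) + θhat j) / 3

/-- `r_q = n` and `rⱼ = ⌊(1/3) θhat_j + (2/3) θhat_{j+1}⌋` for `1 ≤ j ≤ q - 1`
(division in `ℕ` rounds down). -/
def refineRight (q n : ℕ) (θhat : ℕ → ℕ) (j : ℕ) : ℕ :=
  if j = q then n else (θhat j + 2 * θhat (j + 1)) / 3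

/-- `b` maximises the absolute CUSUM over `l < b < r`. -/
def IsCusumArgmax (x : ℕ → ℝ) (l r b : ℕ) : Prop :=
  (l < b ∧ b < r) ∧ ∀ c : ℕ, l < c → c < r → |cusum x l c r| ≤ |cusum x l b r|

/-- `θcheck 1, …, θcheck q` are refined estimates computed from the data `x 1, …, x n`: the WBS2
estimates belonging to the `q` largest max-CUSUMs, refined by maximising the CUSUM over the local
intervals. -/
def IsRefinedEstimate (x : ℕ → ℝ) (q n R : ℕ) (θcheck : ℕ → ℕ) : Prop :=
  ∃ (P₀ : Finset (ℕ × ℕ × ℕ)) (path : List (ℕ × ℕ × ℕ)) (θhat : ℕ → ℕ),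
    IsWBS2 x R 0 n P₀ ∧ IsSolutionPath x P₀ path ∧ IsTopEstimate q path θhat ∧
      ∀ j ∈ Finset.Icc 1 q,
        IsCusumArgmax x (refineLeft θhat j) (refineRight q n θhat j) (θcheck j)

/-! ### Events and assumptions -/

variable {Ω : Type*}

/-- The event that `(e - s)^{-1/2} |∑_{t = s+1}^e Z_t| ≤ ζ` for all `0 ≤ s < e ≤ n`. -/
def noiseEvent (n : ℕ) (Z : ℕ → Ω → ℝ) (ζ : ℝ) : Set Ω :=
  {ω | ∀ s e : ℕ, s < e → e ≤ n →
    |∑ t ∈ Finset.Ioc s e, Z t ω| / Real.sqrt ((e : ℝ) - s) ≤ ζ}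

/-- The event that, for every `1 ≤ j ≤ q`, the sums of the noise over the `k` time points just
before, and just after, `θⱼ` are at most `ζ' k / √(f'ⱼ⁻² a)` in absolute value,
for all `k ≥ f'ⱼ⁻² a` that do not reach beyond the neighbouring change point. -/
def localNoiseEvent (q : ℕ) (θ : ℕ → ℕ) (f' : ℕ → ℝ) (Z : ℕ → Ω → ℝ) (a ζ' : ℝ) : Set Ω :=
  {ω | (∀ j ∈ Finset.Icc 1 q, ∀ k : ℕ, (f' j ^ 2)⁻¹ * a ≤ k → k ≤ θ j - θ (j - 1) →
      Real.sqrt ((f' j ^ 2)⁻¹ * a) / k * |∑ t ∈ Finset.Ioc (θ j - k) (θ j), Z t ω| ≤ ζ')} ∩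
  {ω | (∀ j ∈ Finset.Icc 1 q, ∀ k : ℕ, (f' j ^ 2)⁻¹ * a ≤ k → k ≤ θ (j + 1) - θ j →
      Real.sqrt ((f' j ^ 2)⁻¹ * a) / k * |∑ t ∈ Finset.Ioc (θ j) (θ j + k), Z t ω| ≤ ζ')}

/-- The assumption on the noise `Z n t`, `1 ≤ t ≤ n`: centred, of constant positive variance, with
normalised partial sums uniformly bounded by `ζ n` with probability tending to one, where
`ζ` is between `√log n` and a power of `log n` in order. -/
structure NoiseAssumption [MeasurableSpace Ω] (μ : Measure Ω) (Z : ℕ → ℕ → Ω → ℝ)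
    (ζ : ℕ → ℝ) : Prop where
  measurable : ∀ n, ∀ t ∈ Finset.Icc 1 n, Measurable (Z n t)
  memLp : ∀ n, ∀ t ∈ Finset.Icc 1 n, MemLp (Z n t) 2 μ
  mean : ∀ n, ∀ t ∈ Finset.Icc 1 n, ∫ ω, Z n t ω ∂μ = 0
  variance : ∃ σ : ℝ, 0 < σ ∧ ∀ n, ∀ t ∈ Finset.Icc 1 n, variance (Z n t) μ = σ ^ 2
  rate_lower : (fun n : ℕ => Real.sqrt (Real.log n)) =O[atTop] ζ
  rate_upper : ∃ κ : ℝ, 1 / 2 ≤ κ ∧ ζ =O[atTop] fun n : ℕ => Real.log n ^ κ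
  prob : Tendsto (fun n => μ (noiseEvent n (Z n) (ζ n))) atTop (𝓝 1)

/-- The assumption on the change points: bounded jumps, linearly growing spacings, and
`ζ n ^ 2 / min_j (f'ⱼ² δⱼ) = O(n^{-φ})`. -/
structure ChangePointAssumption (q : ℕ) (θ : ℕ → ℕ → ℕ) (f' : ℕ → ℕ → ℝ) (ζ : ℕ → ℝ) :
    Prop where
  model : ∀ᶠ n in atTop, IsChangePointModel q n (θ n) (f' n)
  jump_bdd : ∃ C : ℝ, ∀ᶠ n in atTop, ∀ j ∈ Finset.Icc 1 q, |f' n j| ≤ C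
  spacing_ge : ∃ c₁ : ℝ, 0 < c₁ ∧ c₁ < 1 ∧
    ∀ᶠ n : ℕ in atTop, ∀ j ∈ Finset.Icc 1 q, c₁ * n ≤ spacing (θ n) j
  signal_strength : ∃ φ : ℝ, 0 < φ ∧ ∃ C : ℝ, ∀ᶠ n : ℕ in atTop, ∀ j ∈ Finset.Icc 1 q,
    ζ n ^ 2 / (f' n j ^ 2 * spacing (θ n) j) ≤ C * (n : ℝ) ^ (-φ)

/-- `a` is, for all large `n`, in the range `1 ≤ a n ≤ min_j f'ⱼ² δⱼ`. -/
def IsAdmissibleScale (q : ℕ) (θ : ℕ → ℕ → ℕ) (f' : ℕ → ℕ → ℝ) (a : ℕ → ℝ) : Prop :=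
  ∀ᶠ n in atTop, 1 ≤ a n ∧ ∀ j ∈ Finset.Icc 1 q, a n ≤ f' n j ^ 2 * spacing (θ n) j

/-- The assumption of a local noise bound with rate `ζ' n`: it is of order at most `ζ n`, bounded
away from zero, and for every admissible scale `a` the local noise event has probability tending
to one. -/
structure LocalNoiseAssumption [MeasurableSpace Ω] (μ : Measure Ω) (q : ℕ) (θ : ℕ → ℕ → ℕ)
    (f' : ℕ → ℕ → ℝ) (Z : ℕ → ℕ → Ω → ℝ) (ζ ζ' : ℕ → ℝ) : Prop where
  rate_upper : ζ' =O[atTop] ζ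
  rate_lower : (fun _ : ℕ => (1 : ℝ)) =O[atTop] ζ'
  prob : ∀ a : ℕ → ℝ, IsAdmissibleScale q θ f' a →
    Tendsto (fun n => μ (localNoiseEvent q (θ n) (f' n) (Z n) (a n) (ζ' n))) atTop (𝓝 1)

/-- The event that refined estimates exist and that every choice of them (whatever the way ties
are broken) satisfies `max_j f'ⱼ² |θcheckⱼ - θⱼ| ≤ ρ`. -/
def refinedEvent (q n R : ℕ) (θ : ℕ → ℕ) (f' : ℕ → ℝ) (X : ℕ → Ω → ℝ) (ρ : ℝ) : Set Ω :=
  {ω | (∃ θcheck, IsRefinedEstimate (fun t => X t ω) q n R θcheck) ∧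
    ∀ θcheck, IsRefinedEstimate (fun t => X t ω) q n R θcheck →
      ∀ j ∈ Finset.Icc 1 q, f' j ^ 2 * |(θcheck j : ℝ) - θ j| ≤ ρ}

end WBS

end

/-! Everything rests on one deterministic inequality. The CUSUM multiplied by the square root of its
`weight` is a centred partial sum, hence linear in the data. For c < b < d, the weighted second
difference of these centred sums is the `contrast` of (c, b] and (b, d], which depends only on the
data in (c, d] and vanishes on constants. The square root of the weight is concave with a quantified
gap (`sqrt_weight_gap`). So if b maximises the CUSUM, a large maximum forces a large contrast around
b (`weight_mul_gap_le`). Where the mean is constant the contrast is pure noise, so a large maximiser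
must sit close to an end of its stretch (`maximiser_near_end`). Conversely, a jump far from the ends
makes some CUSUM large (`jump_le_of_abs_cusum_le`).

For WBS2 the invariant is `IsNear`: both ends of the current interval lie near change points i < i',
with error measured by jump size times square root of distance. If i' = i + 1, every CUSUM inside is
below a fixed multiple of ζ. Otherwise the whole interval, which is always examined, makes the
maximum exceed that multiple, and the split is again `IsNear` to a change point strictly between,
with the same constants. Errors therefore do not accumulate, and exactly q recorded entries exceed
the threshold, one per change point (`Regime.exists_large_entries`, `Regime.exists_top_entries`).

The refinement intervals then isolate one change point each. The same contrast inequality is applied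
there with d or c equal to the change point, and only noise averages adjacent to it enter. The local
event bounds these, which replaces ζ by the local rate (`Regime.abs_argmax_sub_le`). Asymptotics
serve only to show that the deterministic regime holds for large n. -/

namespace WBS

/-! ### Algebra of the CUSUM statistic -/

/-- The centred partial sum of `y` over `(l, b]`, relative to `(l, r]`. -/
noncomputable def centredSum (y : ℕ → ℝ) (l r b : ℕ) : ℝ :=
  ∑ t ∈ Finset.Ioc l b, y t - ((b : ℝ) - l) / ((r : ℝ) - l) * ∑ t ∈ Finset.Ioc l r, y t

/-- The weight `(b - l)(r - b)/(r - l)` of the CUSUM statistic. -/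
noncomputable def weight (l r b : ℕ) : ℝ := ((b : ℝ) - l) * ((r : ℝ) - b) / ((r : ℝ) - l)

/-- The contrast between the sums of `y` over `(c, b]` and `(b, d]` which vanishes on constants. -/
noncomputable def contrast (y : ℕ → ℝ) (c b d : ℕ) : ℝ :=
  ((d : ℝ) - b) * ∑ t ∈ Finset.Ioc c b, y t - ((b : ℝ) - c) * ∑ t ∈ Finset.Ioc b d, y t

lemma sum_Ioc_add {y : ℕ → ℝ} {a b c : ℕ} (hab : a ≤ b) (hbc : b ≤ c) :
    ∑ t ∈ Finset.Ioc a b, y t + ∑ t ∈ Finset.Ioc b c, y t = ∑ t ∈ Finset.Ioc a c, y t := by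
  rw [← Finset.sum_union, Finset.Ioc_union_Ioc_eq_Ioc hab hbc]
  exact Finset.disjoint_left.mpr fun t h1 h2 => by
    rw [Finset.mem_Ioc] at h1 h2; omega

lemma weight_nonneg {l r b : ℕ} (hlb : l ≤ b) (hbr : b ≤ r) : 0 ≤ weight l r b := by
  have h1 : (l : ℝ) ≤ b := by exact_mod_cast hlb
  have h2 : (b : ℝ) ≤ r := by exact_mod_cast hbr
  exact div_nonneg (mul_nonneg (by linarith) (by linarith)) (by linarith)

lemma weight_le_left {l r b : ℕ} (hlb : l ≤ b) (hbr : b ≤ r) : weight l r b ≤ (b : ℝ) - l := by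
  have h1 : (l : ℝ) ≤ b := by exact_mod_cast hlb
  have h2 : (b : ℝ) ≤ r := by exact_mod_cast hbr
  exact div_le_of_le_mul₀ (by linarith) (by linarith) (by nlinarith)

lemma weight_le_right {l r b : ℕ} (hlb : l ≤ b) (hbr : b ≤ r) : weight l r b ≤ (r : ℝ) - b := by
  have h1 : (l : ℝ) ≤ b := by exact_mod_cast hlb
  have h2 : (b : ℝ) ≤ r := by exact_mod_cast hbr
  exact div_le_of_le_mul₀ (by linarith) (by linarith) (by nlinarith)

lemma sqrt_weight_le {l r b : ℕ} {N : ℝ} (hlb : l ≤ b) (hbr : b ≤ r) (hN : (r : ℝ) - l ≤ N) :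
    Real.sqrt (weight l r b) ≤ Real.sqrt N / 2 := by
  have h1 : (l : ℝ) ≤ b := by exact_mod_cast hlb
  have h2 : (b : ℝ) ≤ r := by exact_mod_cast hbr
  have h : weight l r b ≤ N / 4 :=
    div_le_of_le_mul₀ (by linarith) (by linarith)
      (by nlinarith [sq_nonneg ((b : ℝ) - l - (r - b)), mul_nonneg (sub_nonneg.2 (h1.trans h2)) (sub_nonneg.2 hN)])
  calc Real.sqrt (weight l r b) ≤ Real.sqrt (N / 4) := Real.sqrt_le_sqrt h
    _ = Real.sqrt N / 2 := by
        rw [Real.sqrt_div' _ (by norm_num)]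
        congr 1
        rw [show (4 : ℝ) = 2 ^ 2 by norm_num, Real.sqrt_sq (by norm_num)]

/-- Linearises the CUSUM: values at different split points of the same interval become comparable
through partial sums. -/
lemma cusum_mul_sqrt_weight (y : ℕ → ℝ) {l b r : ℕ} (hlb : l < b) (hbr : b < r) :
    cusum y l b r * Real.sqrt (weight l r b) = centredSum y l r b := by
  have h1 : (l : ℝ) < b := by exact_mod_cast hlb
  have h2 : (b : ℝ) < r := by exact_mod_cast hbr
  have e1 : (b : ℝ) - l ≠ 0 := by linarith
  have e2 : (r : ℝ) - b ≠ 0 := by linarith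
  have e3 : (r : ℝ) - l ≠ 0 := by linarith
  have hw := Real.mul_self_sqrt (weight_nonneg hlb.le hbr.le)
  rw [weight] at hw
  rw [cusum, centredSum, weight, ← sum_Ioc_add hlb.le hbr.le, mul_right_comm, hw]
  field_simp
  ring

/-- At x = l and x = r both sides vanish, so a bound over interior split points extends to the
closed interval. This allows c = l or d = r in the contrast inequalities. -/
lemma abs_centredSum_le {y : ℕ → ℝ} {l r x : ℕ} {M : ℝ}
    (hM : ∀ c, l < c → c < r → |cusum y l c r| ≤ M) (hlr : l < r) (hlx : l ≤ x) (hxr : x ≤ r) :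
    |centredSum y l r x| ≤ M * Real.sqrt (weight l r x) := by
  have e3 : (r : ℝ) - l ≠ 0 := by
    have : (l : ℝ) < r := by exact_mod_cast hlr
    linarith
  rcases hlx.eq_or_lt with rfl | h1
  · simp [centredSum, weight]
  rcases hxr.eq_or_lt with rfl | h2
  · simp [centredSum, weight, div_self e3]
  rw [← cusum_mul_sqrt_weight y h1 h2, abs_mul, abs_of_nonneg (Real.sqrt_nonneg _)]
  exact mul_le_mul_of_nonneg_right (hM x h1 h2) (Real.sqrt_nonneg _)

/-- The centring term is linear in the split point and is killed by the second difference, leaving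
only data between c and d. -/
lemma centredSum_interpolation (y : ℕ → ℝ) {l r c b d : ℕ} (hlc : l ≤ c) (hcb : c ≤ b)
    (hbd : b ≤ d) :
    ((d : ℝ) - c) * centredSum y l r b - ((d : ℝ) - b) * centredSum y l r c
      - ((b : ℝ) - c) * centredSum y l r d = contrast y c b d := by
  simp only [centredSum, contrast]
  rw [← sum_Ioc_add (hlc.trans hcb) hbd, ← sum_Ioc_add hlc hcb]
  ring

/-- The square root of the (concave, quadratic) weight lies above its chords, quantitatively. -/
lemma sqrt_weight_gap {l r c b d : ℕ} (hlc : l ≤ c) (hcb : c < b) (hbd : b < d) (hdr : d ≤ r) :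
    ((b : ℝ) - c) * ((d : ℝ) - b) * ((d : ℝ) - c) ≤
      2 * ((r : ℝ) - l) * Real.sqrt (weight l r b) *
        (((d : ℝ) - c) * Real.sqrt (weight l r b) - ((d : ℝ) - b) * Real.sqrt (weight l r c)
          - ((b : ℝ) - c) * Real.sqrt (weight l r d)) := by
  have h1 : (l : ℝ) ≤ c := by exact_mod_cast hlc
  have h2 : (c : ℝ) < b := by exact_mod_cast hcb
  have h3 : (b : ℝ) < d := by exact_mod_cast hbd
  have h4 : (d : ℝ) ≤ r := by exact_mod_cast hdr
  have hL : 0 < (r : ℝ) - l := by linarith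
  have hw := Real.sq_sqrt (weight_nonneg (l := l) (r := r) (b := b) (by omega) (by omega))
  have hw1 := Real.sq_sqrt (weight_nonneg (l := l) (r := r) (b := c) (by omega) (by omega))
  have hw2 := Real.sq_sqrt (weight_nonneg (l := l) (r := r) (b := d) (by omega) (by omega))
  have p0 := Real.sqrt_nonneg (weight l r b)
  have p1 := Real.sqrt_nonneg (weight l r c)
  have p2 := Real.sqrt_nonneg (weight l r d)
  -- The weight is a quadratic with leading coefficient -1/(r - l), so its gap above the chord is
  -- explicit.
  have key : ((r : ℝ) - l) * (((d : ℝ) - c) * weight l r b - ((d : ℝ) - b) * weight l r c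
      - ((b : ℝ) - c) * weight l r d) = ((b : ℝ) - c) * ((d : ℝ) - b) * ((d : ℝ) - c) := by
    simp only [weight]
    field_simp
    ring
  rw [← hw, ← hw1, ← hw2] at key
  rw [← key]
  set p := Real.sqrt (weight l r b)
  set p₁ := Real.sqrt (weight l r c)
  set p₂ := Real.sqrt (weight l r d)
  have hu : 0 < (b : ℝ) - c := by linarith
  have hv : 0 < (d : ℝ) - b := by linarith
  have huv : (d : ℝ) - c = (b - c) + (d - b) := by ring
  rw [huv]
  -- This is exactly 2p times the chord gap of the square roots minus the chord gap of the weights.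
  have : 0 ≤ ((b : ℝ) - c) * (p - p₂) ^ 2 + ((d : ℝ) - b) * (p - p₁) ^ 2 := by positivity
  nlinarith [mul_nonneg hL.le this]

/-- The centred sum attains the envelope M√weight at b and stays below it at c and d. Its second
difference, the contrast, is thus at least M times the second difference of √weight. -/
lemma weight_mul_gap_le {y : ℕ → ℝ} {l r c b d : ℕ} (hlc : l ≤ c) (hcb : c < b) (hbd : b < d)
    (hdr : d ≤ r) (hmax : ∀ x, l < x → x < r → |cusum y l x r| ≤ |cusum y l b r|) :
    |cusum y l b r| * (((b : ℝ) - c) * ((d : ℝ) - b) * ((d : ℝ) - c)) ≤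
      2 * ((r : ℝ) - l) * Real.sqrt (weight l r b) * |contrast y c b d| := by
  have h1 : (l : ℝ) ≤ c := by exact_mod_cast hlc
  have h2 : (c : ℝ) < b := by exact_mod_cast hcb
  have h3 : (b : ℝ) < d := by exact_mod_cast hbd
  have h4 : (d : ℝ) ≤ r := by exact_mod_cast hdr
  set M := |cusum y l b r| with hM
  have hA : |centredSum y l r b| = M * Real.sqrt (weight l r b) := by
    rw [← cusum_mul_sqrt_weight y (by omega) (by omega), abs_mul,
      abs_of_nonneg (Real.sqrt_nonneg _)]
  have hc := abs_centredSum_le hmax (x := c) (by omega) (by omega) (by omega)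
  have hd := abs_centredSum_le hmax (x := d) (by omega) (by omega) (by omega)
  have hT := centredSum_interpolation y (r := r) hlc hcb.le hbd.le
  have hle : ((d : ℝ) - c) * (M * Real.sqrt (weight l r b)) ≤
      ((d : ℝ) - b) * (M * Real.sqrt (weight l r c))
        + ((b : ℝ) - c) * (M * Real.sqrt (weight l r d)) + |contrast y c b d| := by
    rw [← hA, ← abs_of_pos (show 0 < (d : ℝ) - c by linarith), ← abs_mul]
    have : ((d : ℝ) - c) * centredSum y l r b = ((d : ℝ) - b) * centredSum y l r c
      + ((b : ℝ) - c) * centredSum y l r d + contrast y c b d := by linarith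
    rw [this]
    refine (abs_add_three _ _ _).trans ?_
    rw [abs_mul, abs_mul, abs_of_pos (show 0 < (d : ℝ) - b by linarith),
      abs_of_pos (show 0 < (b : ℝ) - c by linarith)]
    have := mul_le_mul_of_nonneg_left hc (show 0 ≤ (d : ℝ) - b by linarith)
    have := mul_le_mul_of_nonneg_left hd (show 0 ≤ (b : ℝ) - c by linarith)
    linarith
  calc _ ≤ M * (2 * ((r : ℝ) - l) * Real.sqrt (weight l r b) *
        (((d : ℝ) - c) * Real.sqrt (weight l r b) - ((d : ℝ) - b) * Real.sqrt (weight l r c)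
          - ((b : ℝ) - c) * Real.sqrt (weight l r d))) :=
        mul_le_mul_of_nonneg_left (sqrt_weight_gap hlc hcb hbd hdr) (abs_nonneg _)
    _ = 2 * ((r : ℝ) - l) * Real.sqrt (weight l r b) *
        (((d : ℝ) - c) * (M * Real.sqrt (weight l r b))
          - ((d : ℝ) - b) * (M * Real.sqrt (weight l r c))
          - ((b : ℝ) - c) * (M * Real.sqrt (weight l r d))) := by ring
    _ ≤ _ := mul_le_mul_of_nonneg_left (by linarith)
        (mul_nonneg (by linarith) (Real.sqrt_nonneg _))

/-- Each of the three centred sums is at most M√N/2, and their coefficients add up to 2(d - c). -/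
lemma abs_contrast_le_of_abs_cusum_le {y : ℕ → ℝ} {l r c b d : ℕ} {M N : ℝ} (hlc : l ≤ c)
    (hcb : c < b) (hbd : b < d) (hdr : d ≤ r) (hN : (r : ℝ) - l ≤ N)
    (hM : ∀ x, l < x → x < r → |cusum y l x r| ≤ M) :
    |contrast y c b d| ≤ ((d : ℝ) - c) * (M * Real.sqrt N) := by
  have h2 : (c : ℝ) < b := by exact_mod_cast hcb
  have h3 : (b : ℝ) < d := by exact_mod_cast hbd
  have hM0 : 0 ≤ M := (abs_nonneg _).trans (hM b (by omega) (by omega))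
  have bd : ∀ x, l ≤ x → x ≤ r → |centredSum y l r x| ≤ M * (Real.sqrt N / 2) := fun x h h' =>
    (abs_centredSum_le hM (by omega) h h').trans
      (mul_le_mul_of_nonneg_left (sqrt_weight_le h h' hN) hM0)
  rw [← centredSum_interpolation y (r := r) hlc hcb.le hbd.le]
  refine (abs_sub _ _).trans ((add_le_add_left (abs_sub _ _) _).trans ?_)
  rw [abs_mul, abs_mul, abs_mul, abs_of_pos (show 0 < (d : ℝ) - c by linarith),
    abs_of_pos (show 0 < (d : ℝ) - b by linarith), abs_of_pos (show 0 < (b : ℝ) - c by linarith)]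
  have k1 := mul_le_mul_of_nonneg_left (bd b (by omega) (by omega)) (show 0 ≤ (d : ℝ) - c by linarith)
  have k2 := mul_le_mul_of_nonneg_left (bd c (by omega) (by omega)) (show 0 ≤ (d : ℝ) - b by linarith)
  have k3 := mul_le_mul_of_nonneg_left (bd d (by omega) (by omega)) (show 0 ≤ (b : ℝ) - c by linarith)
  linarith

lemma contrast_const_add {x z : ℕ → ℝ} {c b d : ℕ} {φ₁ φ₂ : ℝ} (hcb : c ≤ b) (hbd : b ≤ d)
    (h₁ : ∀ t ∈ Finset.Ioc c b, x t = φ₁ + z t) (h₂ : ∀ t ∈ Finset.Ioc b d, x t = φ₂ + z t) :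
    contrast x c b d = ((b : ℝ) - c) * ((d : ℝ) - b) * (φ₁ - φ₂) + contrast z c b d := by
  simp only [contrast]
  rw [Finset.sum_congr rfl h₁, Finset.sum_congr rfl h₂, Finset.sum_add_distrib,
    Finset.sum_add_distrib, Finset.sum_const, Finset.sum_const, Nat.card_Ioc, Nat.card_Ioc,
    nsmul_eq_mul, nsmul_eq_mul, Nat.cast_sub hcb, Nat.cast_sub hbd]
  ring

/-! ### Bounds on the noise -/

/-- All partial sums of `z` within `(0, n]` are at most `ζ` after normalisation. -/
def SumBound (z : ℕ → ℝ) (n : ℕ) (ζ : ℝ) : Prop :=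
  ∀ s e : ℕ, s < e → e ≤ n → |∑ t ∈ Finset.Ioc s e, z t| ≤ ζ * Real.sqrt ((e : ℝ) - s)

lemma abs_contrast_le {z : ℕ → ℝ} {n : ℕ} {ζ : ℝ} (hz : SumBound z n ζ) {c b d : ℕ}
    (hcb : c < b) (hbd : b < d) (hdn : d ≤ n) :
    |contrast z c b d| ≤ ζ * (((d : ℝ) - b) * Real.sqrt ((b : ℝ) - c)
      + ((b : ℝ) - c) * Real.sqrt ((d : ℝ) - b)) := by
  have h2 : (c : ℝ) < b := by exact_mod_cast hcb
  have h3 : (b : ℝ) < d := by exact_mod_cast hbd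
  refine (abs_sub _ _).trans ?_
  rw [abs_mul, abs_mul, abs_of_pos (show 0 < (d : ℝ) - b by linarith),
    abs_of_pos (show 0 < (b : ℝ) - c by linarith)]
  have k1 := mul_le_mul_of_nonneg_left (hz c b hcb (by omega)) (show 0 ≤ (d : ℝ) - b by linarith)
  have k2 := mul_le_mul_of_nonneg_left (hz b d hbd hdn) (show 0 ≤ (b : ℝ) - c by linarith)
  linarith

lemma abs_cusum_noise_le {z : ℕ → ℝ} {n : ℕ} {ζ : ℝ} (hz : SumBound z n ζ) {l b r : ℕ}
    (hlb : l < b) (hbr : b < r) (hrn : r ≤ n) : |cusum z l b r| ≤ 2 * ζ := by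
  have h1 : (l : ℝ) < b := by exact_mod_cast hlb
  have h2 : (b : ℝ) < r := by exact_mod_cast hbr
  have aux : ∀ D S : ℝ, 0 < D → weight l r b ≤ D → |S| ≤ ζ * Real.sqrt D →
      Real.sqrt (weight l r b) * |1 / D * S| ≤ ζ := by
    intro D S hD hw hS
    have hD' := Real.sqrt_pos.2 hD
    rw [abs_mul, abs_of_pos (by positivity)]
    calc Real.sqrt (weight l r b) * (1 / D * |S|)
        ≤ Real.sqrt D * (1 / D * (ζ * Real.sqrt D)) := by gcongr
      _ = ζ := by
          field_simp
          rw [Real.sq_sqrt hD.le]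
  rw [cusum, abs_mul, abs_of_nonneg (Real.sqrt_nonneg _)]
  have k1 := aux _ _ (by linarith) (weight_le_left hlb.le hbr.le) (hz l b hlb (by omega))
  have k2 := aux _ _ (by linarith) (weight_le_right hlb.le hbr.le) (hz b r hbr hrn)
  have k3 := mul_le_mul_of_nonneg_left (abs_sub (1 / ((b : ℝ) - l) * ∑ t ∈ Finset.Ioc l b, z t)
    (1 / ((r : ℝ) - b) * ∑ t ∈ Finset.Ioc b r, z t)) (Real.sqrt_nonneg (weight l r b))
  rw [mul_add] at k3
  unfold weight at k1 k2 k3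
  linarith

/-- A jump in the mean of the data forces a large CUSUM somewhere. -/
lemma jump_le_of_abs_cusum_le {x z : ℕ → ℝ} {n l r c b d : ℕ} {ζ M m φ₁ φ₂ : ℝ}
    (hz : SumBound z n ζ) (hζ : 0 ≤ ζ) (hlc : l ≤ c) (hcb : c < b) (hbd : b < d) (hdr : d ≤ r)
    (hrn : r ≤ n)
    (h₁ : ∀ t ∈ Finset.Ioc c b, x t = φ₁ + z t) (h₂ : ∀ t ∈ Finset.Ioc b d, x t = φ₂ + z t)
    (hm₁ : m ≤ (b : ℝ) - c) (hm₂ : m ≤ (d : ℝ) - b)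
    (hM : ∀ y, l < y → y < r → |cusum x l y r| ≤ M) :
    |φ₁ - φ₂| * (m / 2) ≤ (M + ζ) * Real.sqrt n := by
  have h2 : (c : ℝ) < b := by exact_mod_cast hcb
  have h3 : (b : ℝ) < d := by exact_mod_cast hbd
  have h4 : (d : ℝ) ≤ n := by exact_mod_cast hdr.trans hrn
  have h5 : (r : ℝ) ≤ n := by exact_mod_cast hrn
  have h6 : (0 : ℝ) ≤ l := Nat.cast_nonneg l
  have h7 : (0 : ℝ) ≤ c := Nat.cast_nonneg c
  have hu : 0 < (b : ℝ) - c := by linarith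
  have hv : 0 < (d : ℝ) - b := by linarith
  have e1 := abs_contrast_le_of_abs_cusum_le hlc hcb hbd hdr (N := n) (by linarith) hM
  have e2 := abs_contrast_le hz hcb hbd (hdr.trans hrn)
  rw [contrast_const_add hcb.le hbd.le h₁ h₂] at e1
  have e3 := abs_sub_abs_le_abs_sub (((b : ℝ) - c) * ((d : ℝ) - b) * (φ₁ - φ₂)) (-contrast z c b d)
  rw [sub_neg_eq_add, abs_neg, abs_mul, abs_of_pos (mul_pos hu hv)] at e3
  have s1 : Real.sqrt ((b : ℝ) - c) ≤ Real.sqrt n := Real.sqrt_le_sqrt (by linarith)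
  have s2 : Real.sqrt ((d : ℝ) - b) ≤ Real.sqrt n := Real.sqrt_le_sqrt (by linarith)
  have e4 : ζ * (((d : ℝ) - b) * Real.sqrt ((b : ℝ) - c)
      + ((b : ℝ) - c) * Real.sqrt ((d : ℝ) - b)) ≤ ((d : ℝ) - c) * (ζ * Real.sqrt n) := by
    have := mul_le_mul_of_nonneg_left (add_le_add (mul_le_mul_of_nonneg_left s1 hv.le)
      (mul_le_mul_of_nonneg_left s2 hu.le)) hζ
    linarith
  -- The longer side is at least half of d - c, and the shorter one at least m.
  have e5 : ((d : ℝ) - c) * (m / 2) ≤ ((b : ℝ) - c) * ((d : ℝ) - b) := by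
    rcases le_total ((b : ℝ) - c) ((d : ℝ) - b) with h | h <;> nlinarith
  have e6 := mul_le_mul_of_nonneg_right e5 (abs_nonneg (φ₁ - φ₂))
  have hdc : 0 < (d : ℝ) - c := by linarith
  refine le_of_mul_le_mul_left ?_ hdc
  linarith

/-- A maximiser of the CUSUM lying inside a long stretch of constant mean is close to one of the
ends of this stretch. -/
lemma maximiser_near_end {x z : ℕ → ℝ} {n l r c b d : ℕ} {ζ ρ φ : ℝ}
    (hz : SumBound z n ζ) (hζ : 0 ≤ ζ) (hlc : l ≤ c) (hcb : c < b) (hbd : b < d) (hdr : d ≤ r)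
    (hrn : r ≤ n) (hφ : ∀ t ∈ Finset.Ioc c d, x t = φ + z t)
    (hmax : ∀ y, l < y → y < r → |cusum x l y r| ≤ |cusum x l b r|)
    (hρ : ρ ≤ max ((b : ℝ) - c) ((d : ℝ) - b)) :
    |cusum x l b r| * Real.sqrt (min ((b : ℝ) - c) ((d : ℝ) - b)) * ρ
      ≤ 2 * ζ * (n * Real.sqrt n) := by
  have h2 : (c : ℝ) < b := by exact_mod_cast hcb
  have h3 : (b : ℝ) < d := by exact_mod_cast hbd
  have h5 : (r : ℝ) ≤ n := by exact_mod_cast hrn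
  have h6 : (0 : ℝ) ≤ l := Nat.cast_nonneg l
  have h8 : (l : ℝ) < r := by exact_mod_cast (show l < r by omega)
  have hu : 0 < (b : ℝ) - c := by linarith
  have hv : 0 < (d : ℝ) - b := by linarith
  have e1 := weight_mul_gap_le hlc hcb hbd hdr hmax
  have e2 := abs_contrast_le hz hcb hbd (hdr.trans hrn)
  rw [contrast_const_add hcb.le hbd.le (fun t ht => hφ t ?_) (fun t ht => hφ t ?_), sub_self,
    mul_zero, zero_add] at e1
  rotate_left
  · rw [Finset.mem_Ioc] at ht ⊢; omega
  · rw [Finset.mem_Ioc] at ht ⊢; omega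
  have e3 : 2 * ((r : ℝ) - l) * Real.sqrt (weight l r b) ≤ n * Real.sqrt n := by
    have := sqrt_weight_le (l := l) (r := r) (b := b) (N := n) (by omega) (by omega) (by linarith)
    calc 2 * ((r : ℝ) - l) * Real.sqrt (weight l r b) ≤ 2 * n * (Real.sqrt n / 2) :=
        mul_le_mul (by linarith) this (Real.sqrt_nonneg _) (by positivity)
      _ = _ := by ring
  have e4 : |cusum x l b r| * (((b : ℝ) - c) * ((d : ℝ) - b) * ((d : ℝ) - c)) ≤
      (n * Real.sqrt n) * (ζ * (((d : ℝ) - b) * Real.sqrt ((b : ℝ) - c)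
      + ((b : ℝ) - c) * Real.sqrt ((d : ℝ) - b))) :=
    e1.trans (mul_le_mul e3 e2 (abs_nonneg _) (by positivity))
  -- With u the shorter side, v√u + u√v = √u√v(√u + √v) is at most 2v√u. Cancelling common factors
  -- leaves M√u·v ≤ 2K.
  have aux : ∀ M K u v ρ : ℝ, 0 ≤ M → 0 ≤ K → 0 < u → u ≤ v → ρ ≤ v →
      M * (u * v * (u + v)) ≤ K * (v * Real.sqrt u + u * Real.sqrt v) →
      M * Real.sqrt u * ρ ≤ 2 * K := by
    intro M K u v ρ hM hK hu huv hρ h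
    have hp := Real.sqrt_pos.2 hu
    have hq := Real.sqrt_pos.2 (hu.trans_le huv)
    have hpq := Real.sqrt_le_sqrt huv
    have hpu := Real.sq_sqrt hu.le
    have hqv := Real.sq_sqrt (hu.trans_le huv).le
    set p := Real.sqrt u
    set p' := Real.sqrt v
    refine (mul_le_mul_of_nonneg_left hρ (by positivity)).trans ?_
    rw [← hpu, ← hqv] at h
    rw [← hqv]
    have h' : p * p' * (M * p * p' * (p ^ 2 + p' ^ 2)) ≤ p * p' * (K * (p + p')) := by linarith
    have h'' := le_of_mul_le_mul_left h' (by positivity)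
    have h3 : K * (p + p') ≤ p' * (2 * K) := by nlinarith
    have h4 : p' * (M * p * p' ^ 2) ≤ M * p * p' * (p ^ 2 + p' ^ 2) := by
      have : 0 ≤ M * p * p' * p ^ 2 := by positivity
      linarith
    exact le_of_mul_le_mul_left (h4.trans (h''.trans h3)) hq
  have hK : 0 ≤ (n : ℝ) * Real.sqrt n * ζ := by positivity
  rcases le_total ((b : ℝ) - c) ((d : ℝ) - b) with h | h
  · rw [max_eq_right h] at hρ
    rw [min_eq_left h]
    have := aux _ _ _ _ ρ (abs_nonneg (cusum x l b r)) hK hu h hρ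
      (by convert e4 using 1 <;> ring)
    linarith
  · rw [max_eq_left h] at hρ
    rw [min_eq_right h]
    have := aux _ _ _ _ ρ (abs_nonneg (cusum x l b r)) hK hv h hρ
      (by convert e4 using 1 <;> ring)
    linarith

/-! ### The signal and its CUSUM -/

lemma cusum_add (y z : ℕ → ℝ) (l b r : ℕ) :
    cusum (fun t => y t + z t) l b r = cusum y l b r + cusum z l b r := by
  simp only [cusum, Finset.sum_add_distrib]
  ring

lemma cusum_congr {y z : ℕ → ℝ} {l b r : ℕ} (hlb : l ≤ b) (hbr : b ≤ r)
    (h : ∀ t ∈ Finset.Ioc l r, y t = z t) : cusum y l b r = cusum z l b r := by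
  rw [cusum, cusum, Finset.sum_congr rfl fun t ht => h t ?_,
    Finset.sum_congr (s₁ := Finset.Ioc b r) rfl fun t ht => h t ?_]
  all_goals rw [Finset.mem_Ioc] at ht ⊢; omega

lemma cusum_const (φ : ℝ) {l b r : ℕ} (hlb : l < b) (hbr : b < r) :
    cusum (fun _ => φ) l b r = 0 := by
  have h1 : (l : ℝ) < b := by exact_mod_cast hlb
  have h2 : (b : ℝ) < r := by exact_mod_cast hbr
  have e1 : (b : ℝ) - l ≠ 0 := by linarith
  have e2 : (r : ℝ) - b ≠ 0 := by linarith
  rw [cusum, Finset.sum_const, Finset.sum_const, Nat.card_Ioc, Nat.card_Ioc, nsmul_eq_mul,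
    nsmul_eq_mul, Nat.cast_sub hlb.le, Nat.cast_sub hbr.le]
  field_simp
  simp

lemma cusum_neg (y : ℕ → ℝ) (l b r : ℕ) : cusum (fun t => -y t) l b r = -cusum y l b r := by
  simp only [cusum, Finset.sum_neg_distrib]
  ring

lemma cusum_sum_mul {ι : Type*} (J : Finset ι) (g : ι → ℝ) (y : ι → ℕ → ℝ) (l b r : ℕ) :
    cusum (fun t => ∑ j ∈ J, g j * y j t) l b r = ∑ j ∈ J, g j * cusum (y j) l b r := by
  simp only [cusum]
  rw [Finset.sum_comm, Finset.sum_comm (s := Finset.Ioc b r), Finset.mul_sum, Finset.mul_sum,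
    ← Finset.sum_sub_distrib, Finset.mul_sum]
  refine Finset.sum_congr rfl fun j _ => ?_
  rw [← Finset.mul_sum, ← Finset.mul_sum]
  ring

/-- The unit step at `θ`. -/
noncomputable def step (θ t : ℕ) : ℝ := if θ + 1 ≤ t then 1 else 0

lemma step_nonneg (θ t : ℕ) : 0 ≤ step θ t := by unfold step; split_ifs <;> norm_num

lemma step_le_one (θ t : ℕ) : step θ t ≤ 1 := by unfold step; split_ifs <;> norm_num

/-- The CUSUM of data in `[0, 1]` is bounded in terms of the total and of the weight. -/
lemma abs_cusum_le_of_mem_unit {y : ℕ → ℝ} (h0 : ∀ t, 0 ≤ y t) (h1 : ∀ t, y t ≤ 1) {l b r : ℕ}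
    (hlb : l < b) (hbr : b < r) :
    |cusum y l b r| ≤ Real.sqrt (weight l r b) ∧
      |cusum y l b r| ≤ Real.sqrt (∑ t ∈ Finset.Ioc l r, y t) := by
  have k1 : (l : ℝ) < b := by exact_mod_cast hlb
  have k2 : (b : ℝ) < r := by exact_mod_cast hbr
  have hT := sum_Ioc_add (y := y) hlb.le hbr.le
  have hnn : ∀ c d, 0 ≤ ∑ t ∈ Finset.Ioc c d, y t := fun c d => Finset.sum_nonneg fun t _ => h0 t
  have hle : ∀ c d : ℕ, c ≤ d → ∑ t ∈ Finset.Ioc c d, y t ≤ (d : ℝ) - c := by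
    intro c d hcd
    have := Finset.sum_le_card_nsmul (Finset.Ioc c d) y 1 fun t _ => h1 t
    rwa [Nat.card_Ioc, nsmul_eq_mul, mul_one, Nat.cast_sub hcd] at this
  have aux : ∀ D S : ℝ, 0 < D → weight l r b ≤ D → 0 ≤ S → S ≤ D →
      S ≤ ∑ t ∈ Finset.Ioc l r, y t →
      0 ≤ Real.sqrt (weight l r b) * (1 / D * S) ∧
      Real.sqrt (weight l r b) * (1 / D * S) ≤ Real.sqrt (weight l r b) ∧
      Real.sqrt (weight l r b) * (1 / D * S) ≤ Real.sqrt (∑ t ∈ Finset.Ioc l r, y t) := by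
    intro D S hD hw hS hSD hST
    refine ⟨by positivity, mul_le_of_le_one_right (Real.sqrt_nonneg _) ?_, ?_⟩
    · rw [one_div_mul_eq_div]
      exact div_le_one_of_le₀ hSD hD.le
    · refine le_trans ?_ (Real.sqrt_le_sqrt hST)
      have hD' := Real.sqrt_pos.2 hD
      have hS' := Real.sqrt_le_sqrt hSD
      calc Real.sqrt (weight l r b) * (1 / D * S)
          ≤ Real.sqrt D * (1 / D * (Real.sqrt S * Real.sqrt D)) := by
            gcongr
            calc S = Real.sqrt S * Real.sqrt S := (Real.mul_self_sqrt hS).symm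
              _ ≤ _ := by gcongr
        _ = Real.sqrt S := by
            field_simp
            rw [Real.sq_sqrt hD.le]
  obtain ⟨a1, a2, a3⟩ := aux _ _ (by linarith) (weight_le_left hlb.le hbr.le) (hnn l b)
    (hle l b hlb.le) (by linarith [hnn b r])
  obtain ⟨b1, b2, b3⟩ := aux _ _ (by linarith) (weight_le_right hlb.le hbr.le) (hnn b r)
    (hle b r hbr.le) (by linarith [hnn l b])
  rw [cusum, mul_sub]
  unfold weight at *
  constructor <;> rw [abs_le] <;> constructor <;> linarith

lemma abs_cusum_step_le_weight (θ : ℕ) {l b r : ℕ} (hlb : l < b) (hbr : b < r) :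
    |cusum (step θ) l b r| ≤ Real.sqrt (weight l r b) :=
  (abs_cusum_le_of_mem_unit (step_nonneg θ) (step_le_one θ) hlb hbr).1

lemma abs_cusum_step_le_min (θ : ℕ) {l b r : ℕ} (hlb : l < b) (hbr : b < r) :
    |cusum (step θ) l b r| ≤ Real.sqrt (min ((b : ℝ) - l) ((r : ℝ) - b)) :=
  (abs_cusum_step_le_weight θ hlb hbr).trans
    (Real.sqrt_le_sqrt (le_min (weight_le_left hlb.le hbr.le) (weight_le_right hlb.le hbr.le)))

lemma sum_step_le (θ l r : ℕ) :
    ∑ t ∈ Finset.Ioc l r, step θ t ≤ max 0 ((r : ℝ) - θ) := by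
  have : ∑ t ∈ Finset.Ioc l r, step θ t ≤ ((Finset.Ioc θ r).card : ℝ) := by
    simp only [step]
    rw [← Finset.sum_filter, Finset.sum_const, nsmul_eq_mul, mul_one]
    exact_mod_cast Finset.card_le_card fun t ht => by
      simp only [Finset.mem_filter, Finset.mem_Ioc] at ht ⊢
      omega
  refine this.trans ?_
  rw [Nat.card_Ioc]
  rcases le_total θ r with h' | h'
  · rw [Nat.cast_sub h']; exact le_max_right _ _
  · rw [Nat.sub_eq_zero_of_le h', Nat.cast_zero]; exact le_max_left _ _

lemma sum_one_sub_step_le (θ l r : ℕ) :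
    ∑ t ∈ Finset.Ioc l r, (1 - step θ t) ≤ max 0 ((θ : ℝ) - l) := by
  have : ∑ t ∈ Finset.Ioc l r, (1 - step θ t) ≤ ((Finset.Ioc l θ).card : ℝ) := by
    have e : ∀ t, 1 - step θ t = if t ≤ θ then 1 else 0 := by
      intro t
      unfold step
      split_ifs <;> first | omega | norm_num
    simp only [e]
    rw [← Finset.sum_filter, Finset.sum_const, nsmul_eq_mul, mul_one]
    exact_mod_cast Finset.card_le_card fun t ht => by
      simp only [Finset.mem_filter, Finset.mem_Ioc] at ht ⊢
      omega
  refine this.trans ?_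
  rw [Nat.card_Ioc]
  rcases le_total l θ with h' | h'
  · rw [Nat.cast_sub h']; exact le_max_right _ _
  · rw [Nat.sub_eq_zero_of_le h', Nat.cast_zero]; exact le_max_left _ _

/-- A step that occurs just before the right end, or beyond it, hardly contributes. This and its
mirror image below handle the change points already detected. -/
lemma abs_cusum_step_le_right (θ : ℕ) {l b r : ℕ} (hlb : l < b) (hbr : b < r) :
    |cusum (step θ) l b r| ≤ Real.sqrt (max 0 ((r : ℝ) - θ)) :=
  (abs_cusum_le_of_mem_unit (step_nonneg θ) (step_le_one θ) hlb hbr).2.trans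
    (Real.sqrt_le_sqrt (sum_step_le θ l r))

/-- The CUSUM annihilates constants, so the step may be replaced by one minus the step, whose mass
lies to the left of θ. -/
lemma abs_cusum_step_le_left (θ : ℕ) {l b r : ℕ} (hlb : l < b) (hbr : b < r) :
    |cusum (step θ) l b r| ≤ Real.sqrt (max 0 ((θ : ℝ) - l)) := by
  have h := cusum_add (fun _ => 1) (fun t => -step θ t) l b r
  rw [cusum_const 1 hlb hbr, cusum_neg, zero_add] at h
  rw [← abs_neg, ← h]
  simp only [← sub_eq_add_neg]
  exact (abs_cusum_le_of_mem_unit (fun t => sub_nonneg.2 (step_le_one θ t))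
    (fun t => sub_le_self _ (step_nonneg θ t)) hlb hbr).2.trans
    (Real.sqrt_le_sqrt (sum_one_sub_step_le θ l r))

lemma signal_eq_sum_step (q : ℕ) (θ : ℕ → ℕ) (f' : ℕ → ℝ) (f₀ : ℝ) (t : ℕ) :
    signal q θ f' f₀ t = f₀ + ∑ j ∈ Finset.Icc 1 q, f' j * step (θ j) t := by
  simp [signal, step]

/-- The triangle inequality for the CUSUM of signal plus noise. -/
lemma abs_cusum_le_sum {q n : ℕ} {θ : ℕ → ℕ} {f' : ℕ → ℝ} {f₀ ζ : ℝ} {x z : ℕ → ℝ}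
    (hx : ∀ t ∈ Finset.Icc 1 n, x t = signal q θ f' f₀ t + z t) (hz : SumBound z n ζ)
    {l b r : ℕ} (hlb : l < b) (hbr : b < r) (hrn : r ≤ n) {K : ℝ}
    (hK : ∀ j ∈ Finset.Icc 1 q, |f' j| * |cusum (step (θ j)) l b r| ≤ K) :
    |cusum x l b r| ≤ 2 * ζ + q * K := by
  rw [cusum_congr hlb.le hbr.le (z := fun t => (f₀ + ∑ j ∈ Finset.Icc 1 q, f' j * step (θ j) t)
    + z t) fun t ht => ?_]
  · rw [cusum_add, cusum_add, cusum_const f₀ hlb hbr, cusum_sum_mul, zero_add]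
    refine (abs_add_le _ _).trans ?_
    have h1 := abs_cusum_noise_le hz hlb hbr hrn
    have h2 := (Finset.abs_sum_le_sum_abs (fun j => f' j * cusum (step (θ j)) l b r)
      (Finset.Icc 1 q)).trans (Finset.sum_le_card_nsmul _ _ K fun j hj => by
        rw [abs_mul]; exact hK j hj)
    rw [Nat.card_Icc, nsmul_eq_mul, Nat.add_sub_cancel] at h2
    linarith
  · rw [← signal_eq_sum_step]
    refine hx t ?_
    rw [Finset.mem_Ioc] at ht
    rw [Finset.mem_Icc]
    omega

/-- The mean level between the `k`-th and the `(k + 1)`-st change point. -/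
noncomputable def level (f' : ℕ → ℝ) (f₀ : ℝ) (k : ℕ) : ℝ := f₀ + ∑ j ∈ Finset.Icc 1 k, f' j

lemma level_succ (f' : ℕ → ℝ) (f₀ : ℝ) (k : ℕ) :
    level f' f₀ (k + 1) = level f' f₀ k + f' (k + 1) := by
  rw [level, level, Finset.sum_Icc_succ_top (by omega), add_assoc]

/-- The change points are increasing. -/
lemma IsChangePointModel.mono {q n : ℕ} {θ : ℕ → ℕ} {f' : ℕ → ℝ} (h : IsChangePointModel q n θ f')
    {i j : ℕ} (hij : i ≤ j) (hj : j ≤ q + 1) : θ i ≤ θ j := by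
  induction j, hij using Nat.le_induction with
  | base => exact le_rfl
  | succ m hm ih =>
    exact (ih (by omega)).trans (h.lt m (Finset.mem_range.2 (by omega))).le

lemma IsChangePointModel.signal_eq_level {q n : ℕ} {θ : ℕ → ℕ} {f' : ℕ → ℝ}
    (h : IsChangePointModel q n θ f') (f₀ : ℝ) {k t : ℕ} (hk : k ≤ q) (h1 : θ k < t)
    (h2 : t ≤ θ (k + 1)) : signal q θ f' f₀ t = level f' f₀ k := by
  rw [signal, level, ← Finset.sum_filter]
  congr 2
  ext j
  simp only [Finset.mem_filter, Finset.mem_Icc]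
  constructor
  · rintro ⟨⟨hj1, hjq⟩, ht⟩
    refine ⟨hj1, ?_⟩
    by_contra hjk
    have := h.mono (show k + 1 ≤ j by omega) (by omega)
    omega
  · rintro ⟨hj1, hjk⟩
    have := h.mono hjk (by omega)
    exact ⟨⟨hj1, by omega⟩, by omega⟩

/-- Every time before `n` lies between two consecutive change points. -/
lemma IsChangePointModel.exists_between {q n : ℕ} {θ : ℕ → ℕ} {f' : ℕ → ℝ}
    (h : IsChangePointModel q n θ f') {b : ℕ} (hb : b < n) :
    ∃ k ≤ q, θ k ≤ b ∧ b < θ (k + 1) := by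
  have hex : ∃ k, b < θ (k + 1) := ⟨q, by rw [h.last]; exact hb⟩
  refine ⟨Nat.find hex, Nat.find_le (by rw [h.last]; exact hb), ?_, Nat.find_spec hex⟩
  rcases Nat.eq_zero_or_pos (Nat.find hex) with h0 | h0
  · rw [h0, h.first]; exact Nat.zero_le _
  · have := Nat.find_min hex (m := Nat.find hex - 1) (by omega)
    rw [Nat.sub_add_cancel h0] at this
    omega

/-! ### The deterministic regime -/

/-- Distance to the ends of an interval, relative to `n`, kept by the large CUSUMs. -/
noncomputable def tol (c : ℝ) (q : ℕ) : ℝ := (c / (16 * q)) ^ 2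

/-- The constant in the localisation rate of the preliminary estimates. -/
noncomputable def locConst (c : ℝ) (q : ℕ) : ℝ := 16 / (c * tol c q)

/-- The multiple of `ζ` separating the small from the large CUSUMs. -/
noncomputable def threshConst (c : ℝ) (q : ℕ) : ℝ := 2 + q * locConst c q

/-- The signal-to-noise ratio needed for detection. -/
noncomputable def snrConst (c : ℝ) (q : ℕ) : ℝ := 32 * threshConst c q / c

/-- Data `x` with `q` linearly spaced change points, and with noise `z` at most of level `ζ`,
which is small relative to the jumps. -/
structure Regime (c : ℝ) (q n : ℕ) (θ : ℕ → ℕ) (f' : ℕ → ℝ) (f₀ : ℝ) (x z : ℕ → ℝ) (ζ : ℝ) :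
    Prop where
  q_pos : 1 ≤ q
  c_pos : 0 < c
  c_lt : c < 1
  model : IsChangePointModel q n θ f'
  data : ∀ t ∈ Finset.Icc 1 n, x t = signal q θ f' f₀ t + z t
  noise : SumBound z n ζ
  level_nonneg : 0 ≤ ζ
  gap_succ : ∀ k ≤ q, c * n ≤ (θ (k + 1) : ℝ) - θ k
  snr : ∀ j ∈ Finset.Icc 1 q, snrConst c q * ζ ≤ |f' j| * Real.sqrt n

/-- The time `s` is close to the `i`-th change point, relative to the size of its jump. -/
def IsNear (c : ℝ) (q n : ℕ) (θ : ℕ → ℕ) (f' : ℕ → ℝ) (ζ : ℝ) (s i : ℕ) : Prop :=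
  |(s : ℝ) - θ i| ≤ tol c q * n / 4 ∧ |f' i| * Real.sqrt |(s : ℝ) - θ i| ≤ locConst c q * ζ

section Constants

variable {c : ℝ} {q : ℕ}

lemma tol_pos (hc : 0 < c) (hq : 1 ≤ q) : 0 < tol c q := by
  have : (0 : ℝ) < q := by exact_mod_cast hq
  unfold tol
  positivity

lemma tol_le (hc : 0 < c) (hc' : c < 1) (hq : 1 ≤ q) : tol c q ≤ c / 256 := by
  have hq1 : (1 : ℝ) ≤ q := by exact_mod_cast hq
  have : c / (16 * q) ≤ c / 16 := div_le_div_of_nonneg_left hc.le (by norm_num) (by linarith)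
  calc tol c q ≤ (c / 16) ^ 2 := pow_le_pow_left₀ (by positivity) this 2
    _ ≤ c / 256 := by nlinarith

lemma locConst_pos (hc : 0 < c) (hq : 1 ≤ q) : 0 < locConst c q :=
  div_pos (by norm_num) (mul_pos hc (tol_pos hc hq))

lemma two_le_threshConst (hc : 0 < c) (hq : 1 ≤ q) : 2 ≤ threshConst c q := by
  have := mul_nonneg (Nat.cast_nonneg (α := ℝ) q) (locConst_pos hc hq).le
  unfold threshConst
  linarith

end Constants

section Deterministic

variable {c : ℝ} {q n : ℕ} {θ : ℕ → ℕ} {f' : ℕ → ℝ} {f₀ : ℝ} {x z : ℕ → ℝ} {ζ : ℝ}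

lemma Regime.n_pos (h : Regime c q n θ f' f₀ x z ζ) : 0 < n := by
  have h1 := h.model.lt 0 (Finset.mem_range.2 (by omega))
  have h2 := h.model.mono (show 0 + 1 ≤ q + 1 by omega) le_rfl
  rw [h.model.last] at h2
  omega

lemma Regime.gap (h : Regime c q n θ f' f₀ x z ζ) {i j : ℕ} (hij : i < j) (hj : j ≤ q + 1) :
    c * n ≤ (θ j : ℝ) - θ i := by
  have h1 := h.gap_succ i (by omega)
  have h2 : (θ (i + 1) : ℝ) ≤ θ j := by exact_mod_cast h.model.mono hij hj
  linarith

lemma Regime.le_n (h : Regime c q n θ f' f₀ x z ζ) {j : ℕ} (hj : j ≤ q + 1) : θ j ≤ n := by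
  rw [← h.model.last]
  exact h.model.mono hj le_rfl

lemma Regime.tol_mul_pos (h : Regime c q n θ f' f₀ x z ζ) : 0 < tol c q * n :=
  mul_pos (tol_pos h.c_pos h.q_pos) (by exact_mod_cast h.n_pos)

lemma Regime.tol_mul_le (h : Regime c q n θ f' f₀ x z ζ) : tol c q * n ≤ c * n / 256 := by
  have := mul_le_mul_of_nonneg_right (tol_le h.c_pos h.c_lt h.q_pos) (Nat.cast_nonneg (α := ℝ) n)
  linarith

lemma Regime.data_eq_level (h : Regime c q n θ f' f₀ x z ζ) {k t : ℕ} (hk : k ≤ q)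
    (h1 : θ k < t) (h2 : t ≤ θ (k + 1)) : x t = level f' f₀ k + z t := by
  rw [h.data t, h.model.signal_eq_level f₀ hk h1 h2]
  have := h.le_n (show k + 1 ≤ q + 1 by omega)
  rw [Finset.mem_Icc]
  omega

lemma Regime.near_self (h : Regime c q n θ f' f₀ x z ζ) (k : ℕ) :
    IsNear c q n θ f' ζ (θ k) k := by
  have h1 := h.tol_mul_pos
  have h2 := mul_nonneg (locConst_pos h.c_pos h.q_pos).le h.level_nonneg
  constructor
  · simp only [sub_self, abs_zero]; linarith
  · simpa using h2

lemma Regime.lt_of_near_right (h : Regime c q n θ f' f₀ x z ζ) {s i j : ℕ}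
    (hs : IsNear c q n θ f' ζ s i) (hij : i < j) (hj : j ≤ q + 1) : s < θ j := by
  have h1 := h.gap hij hj
  have h2 := (abs_le.1 hs.1).2
  have h3 := h.tol_mul_pos
  have h4 := h.tol_mul_le
  exact_mod_cast show (s : ℝ) < θ j by linarith

lemma Regime.lt_of_near_left (h : Regime c q n θ f' f₀ x z ζ) {s i j : ℕ}
    (hs : IsNear c q n θ f' ζ s i) (hij : j < i) (hi : i ≤ q + 1) : θ j < s := by
  have h1 := h.gap hij hi
  have h2 := (abs_le.1 hs.1).1
  have h3 := h.tol_mul_pos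
  have h4 := h.tol_mul_le
  exact_mod_cast show (θ j : ℝ) < s by linarith

/-- Change points with index at most i, or at least i', lie at most a quarter of the tolerance
inside the interval, whereas b keeps the full tolerance from both ends. -/
lemma Regime.index_mem (h : Regime c q n θ f' f₀ x z ζ) {s e b i i' k : ℕ}
    (hs : IsNear c q n θ f' ζ s i) (he : IsNear c q n θ f' ζ e i') (hi : i ≤ q + 1)
    (hk : k ≤ q + 1) (hsb : tol c q * n ≤ (b : ℝ) - s)
    (hbe : tol c q * n ≤ (e : ℝ) - b) (hb : |(b : ℝ) - θ k| ≤ tol c q * n / 4) :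
    k ∈ Finset.Ioo i i' := by
  have h3 := h.tol_mul_pos
  have h5 := abs_le.1 hb
  have h6 := abs_le.1 hs.1
  have h7 := abs_le.1 he.1
  rw [Finset.mem_Ioo]
  by_contra hcon
  rcases lt_or_ge i k with hik | hik
  · have hik' : i' ≤ k := by omega
    have : (θ i' : ℝ) ≤ θ k := by exact_mod_cast h.model.mono hik' hk
    linarith
  · have : (θ k : ℝ) ≤ θ i := by exact_mod_cast h.model.mono hik hi
    linarith

lemma Regime.thresh_le (h : Regime c q n θ f' f₀ x z ζ) {G : ℝ}
    (hG : snrConst c q * ζ ≤ G * Real.sqrt n) :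
    threshConst c q * ζ ≤ c * (G * Real.sqrt n) / 32 := by
  have hc := h.c_pos
  have : threshConst c q * ζ = c * (snrConst c q * ζ) / 32 := by
    unfold snrConst
    field_simp
  rw [this]
  have := mul_le_mul_of_nonneg_left hG hc.le
  linarith

/-- The maximal CUSUM on a stretch containing a jump of size `G` far from the ends. -/
lemma Regime.large (h : Regime c q n θ f' f₀ x z ζ) {G M : ℝ}
    (hG : snrConst c q * ζ ≤ G * Real.sqrt n)
    (hM : G * (c * n / 2 / 2) ≤ (M + ζ) * Real.sqrt n) :
    threshConst c q * ζ + c * (G * Real.sqrt n) / 8 ≤ M := by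
  have hn : (0 : ℝ) < n := by exact_mod_cast h.n_pos
  have hsn := Real.sqrt_pos.2 hn
  have h1 := h.thresh_le hG
  -- As the threshold constant is at least 2, ζ is at most c G√n/64, and 1/4 - 1/64 exceeds 1/8 +
  -- 1/32.
  have h2 := mul_le_mul_of_nonneg_right (two_le_threshConst h.c_pos h.q_pos) h.level_nonneg
  have h3 : c * (G * Real.sqrt n) / 4 ≤ M + ζ := by
    refine le_of_mul_le_mul_right ?_ hsn
    calc c * (G * Real.sqrt n) / 4 * Real.sqrt n
        = G * (c * (Real.sqrt n * Real.sqrt n) / 2 / 2) := by ring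
      _ ≤ _ := by rwa [Real.mul_self_sqrt hn.le]
  linarith [h.level_nonneg]

/-- A large CUSUM has its split point far from the ends. -/
lemma Regime.tol_le_of_large (h : Regime c q n θ f' f₀ x z ζ) {G M m : ℝ} (hG : 0 < G)
    (hm : 0 ≤ m) (hlow : threshConst c q * ζ + c * (G * Real.sqrt n) / 8 ≤ M)
    (hup : M ≤ 2 * ζ + q * (locConst c q * ζ + G * Real.sqrt m)) : tol c q * n ≤ m := by
  have hq : (0 : ℝ) < q := by exact_mod_cast h.q_pos
  have hc := h.c_pos
  have h1 : c * Real.sqrt n / 8 ≤ q * Real.sqrt m := by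
    refine le_of_mul_le_mul_left ?_ hG
    unfold threshConst at hlow
    linarith
  have h2 : c / (16 * q) * Real.sqrt n ≤ Real.sqrt m := by
    refine le_of_mul_le_mul_left ?_ hq
    have : q * (c / (16 * q) * Real.sqrt n) = c * Real.sqrt n / 16 := by
      field_simp
    rw [this]
    have : 0 ≤ c * Real.sqrt n := by positivity
    linarith
  have h3 := pow_le_pow_left₀ (by positivity) h2 2
  rwa [mul_pow, Real.sq_sqrt (Nat.cast_nonneg n), Real.sq_sqrt hm] at h3

/-- The CUSUM over an interval with ends close to the `i`-th and `i'`-th change points. -/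
lemma Regime.abs_cusum_le (h : Regime c q n θ f' f₀ x z ζ) {s e i i' l b r : ℕ} {G : ℝ}
    (hs : IsNear c q n θ f' ζ s i) (he : IsNear c q n θ f' ζ e i') (hi : i < i')
    (hi' : i' ≤ q + 1) (hen : e ≤ n) (hsl : s ≤ l) (hlb : l < b) (hbr : b < r) (hre : r ≤ e)
    (hG0 : 0 ≤ G) (hG : ∀ j ∈ Finset.Ioo i i', |f' j| ≤ G) :
    |cusum x l b r| ≤ 2 * ζ + q * (locConst c q * ζ
      + G * Real.sqrt (min ((b : ℝ) - l) ((r : ℝ) - b))) := by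
  have hB := mul_nonneg (locConst_pos h.c_pos h.q_pos).le h.level_nonneg
  have hsl' : (s : ℝ) ≤ l := by exact_mod_cast hsl
  have hre' : (r : ℝ) ≤ e := by exact_mod_cast hre
  have hGm : 0 ≤ G * Real.sqrt (min ((b : ℝ) - l) ((r : ℝ) - b)) := by positivity
  -- The i-th step may reach into the interval, but `IsNear` bounds its effect. Earlier steps lie
  -- before s and contribute nothing.
  have left : ∀ j, j ≤ i → |f' j| * |cusum (step (θ j)) l b r| ≤ locConst c q * ζ := by
    intro j hj
    refine (mul_le_mul_of_nonneg_left (abs_cusum_step_le_left _ hlb hbr) (abs_nonneg _)).trans ?_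
    rcases hj.eq_or_lt with rfl | hj
    · refine le_trans (mul_le_mul_of_nonneg_left (Real.sqrt_le_sqrt ?_) (abs_nonneg _)) hs.2
      refine max_le (abs_nonneg _) ?_
      rw [abs_sub_comm]
      exact le_trans (by linarith) (le_abs_self _)
    · have : (θ j : ℝ) < s := by exact_mod_cast h.lt_of_near_left hs hj (by omega)
      rw [max_eq_left (by linarith)]
      simpa using hB
  have right : ∀ j, i' ≤ j → j ≤ q → |f' j| * |cusum (step (θ j)) l b r| ≤ locConst c q * ζ := by
    intro j hj hjq
    refine (mul_le_mul_of_nonneg_left (abs_cusum_step_le_right _ hlb hbr) (abs_nonneg _)).trans ?_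
    rcases hj.eq_or_lt with rfl | hj
    · refine le_trans (mul_le_mul_of_nonneg_left (Real.sqrt_le_sqrt ?_) (abs_nonneg _)) he.2
      exact max_le (abs_nonneg _) (le_trans (by linarith) (le_abs_self _))
    · have : (e : ℝ) < θ j := by exact_mod_cast h.lt_of_near_right he hj (by omega)
      rw [max_eq_left (by linarith)]
      simpa using hB
  refine abs_cusum_le_sum h.data h.noise hlb hbr (hre.trans hen) fun j hj => ?_
  rw [Finset.mem_Icc] at hj
  rcases le_or_gt j i with h1 | h1
  · linarith [left j h1]
  rcases le_or_gt i' j with h2 | h2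
  · linarith [right j h2 hj.2]
  have := mul_le_mul (hG j (Finset.mem_Ioo.2 ⟨h1, h2⟩)) (abs_cusum_step_le_min (θ j) hlb hbr)
    (abs_nonneg _) hG0
  linarith

/-- Without an undetected change point, all CUSUMs are small. -/
lemma Regime.abs_cusum_le_thresh (h : Regime c q n θ f' f₀ x z ζ) {s e i l b r : ℕ}
    (hs : IsNear c q n θ f' ζ s i) (he : IsNear c q n θ f' ζ e (i + 1)) (hi : i ≤ q)
    (hen : e ≤ n) (hsl : s ≤ l) (hlb : l < b) (hbr : b < r) (hre : r ≤ e) :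
    |cusum x l b r| ≤ threshConst c q * ζ := by
  have := h.abs_cusum_le (G := 0) hs he (by omega) (by omega) hen hsl hlb hbr hre le_rfl
    fun j hj => by rw [Finset.mem_Ioo] at hj; omega
  unfold threshConst
  linarith

/-- With an undetected change point, the split with the maximal CUSUM is close to an undetected
change point, and its CUSUM is large. -/
lemma Regime.exists_near_of_max (h : Regime c q n θ f' f₀ x z ζ) {s e i i' l b r : ℕ}
    (hs : IsNear c q n θ f' ζ s i) (he : IsNear c q n θ f' ζ e i') (hi : i + 1 < i')
    (hi' : i' ≤ q + 1) (hen : e ≤ n) (hsl : s ≤ l) (hlb : l < b) (hbr : b < r) (hre : r ≤ e)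
    (hmax : ∀ y, l < y → y < r → |cusum x l y r| ≤ |cusum x l b r|)
    (hmax' : ∀ y, s < y → y < e → |cusum x s y e| ≤ |cusum x l b r|) :
    (∃ k ∈ Finset.Ioo i i', IsNear c q n θ f' ζ b k) ∧
      threshConst c q * ζ < |cusum x l b r| := by
  have hc := h.c_pos
  have hε := h.tol_mul_pos
  have hε' := h.tol_mul_le
  have hζ := h.level_nonneg
  have hn : (0 : ℝ) < n := by exact_mod_cast h.n_pos
  have hsn := Real.sqrt_pos.2 hn
  have htol := tol_pos h.c_pos h.q_pos
  -- The largest undetected jump G bounds the maximum from below and dominates every undetected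
  -- jump, so a localisation bound stated with G serves whichever change point b turns out to be
  -- near.
  obtain ⟨k₀, hk₀, hk₀max⟩ := Finset.exists_max_image (Finset.Ioo i i') (fun j => |f' j|)
    ⟨i + 1, Finset.mem_Ioo.2 ⟨by omega, hi⟩⟩
  have hk₀' := Finset.mem_Ioo.1 hk₀
  have hk₀q : k₀ ∈ Finset.Icc 1 q := Finset.mem_Icc.2 ⟨by omega, by omega⟩
  obtain ⟨p, rfl⟩ : ∃ p, k₀ = p + 1 := ⟨k₀ - 1, by omega⟩
  set G := |f' (p + 1)| with hGdef
  have hG : 0 < G := abs_pos.2 (h.model.jump_ne _ hk₀q)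
  have hsnr := h.snr _ hk₀q
  -- the maximal CUSUM is large
  have hcs : s < θ (p + 1) := h.lt_of_near_right hs hk₀'.1 (by omega)
  have hce : θ (p + 1) < e := h.lt_of_near_left he hk₀'.2 hi'
  have hM : threshConst c q * ζ + c * (G * Real.sqrt n) / 8 ≤ |cusum x l b r| := by
    refine h.large hsnr ?_
    have hjump := jump_le_of_abs_cusum_le (x := x) (l := s) (r := e) (c := max s (θ p))
      (b := θ (p + 1)) (d := min e (θ (p + 1 + 1))) (m := c * n / 2) (φ₁ := level f' f₀ p)
      (φ₂ := level f' f₀ (p + 1)) h.noise hζ (le_max_left _ _)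
      (max_lt hcs (h.model.lt p (Finset.mem_range.2 (by omega))))
      (lt_min hce (h.model.lt (p + 1) (Finset.mem_range.2 (by omega)))) (min_le_left _ _) hen
      (fun t ht => ?_) (fun t ht => ?_) ?_ ?_ hmax'
    · rwa [level_succ, sub_add_cancel_left, abs_neg] at hjump
    · rw [Finset.mem_Ioc, max_lt_iff] at ht
      exact h.data_eq_level (by omega) ht.1.2 ht.2
    · rw [Finset.mem_Ioc, le_min_iff] at ht
      exact h.data_eq_level (by omega) ht.1 ht.2.2
    · rw [Nat.cast_max]
      have h1 := h.gap_succ p (by omega)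
      have h2 := h.gap hk₀'.1 (by omega)
      have h3 := (abs_le.1 hs.1).2
      rcases max_cases (s : ℝ) (θ p : ℝ) with ⟨h4, _⟩ | ⟨h4, _⟩ <;> rw [h4] <;> linarith
    · rw [Nat.cast_min]
      have h1 := h.gap_succ (p + 1) (by omega)
      have h2 := h.gap hk₀'.2 hi'
      have h3 := (abs_le.1 he.1).1
      rcases min_cases (e : ℝ) (θ (p + 1 + 1) : ℝ) with ⟨h4, _⟩ | ⟨h4, _⟩ <;> rw [h4] <;> linarith
  have hGn : 0 < c * (G * Real.sqrt n) := by positivity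
  refine ⟨?_, by linarith⟩
  -- the split point is far from the ends
  have hlb' : (l : ℝ) < b := by exact_mod_cast hlb
  have hbr' : (b : ℝ) < r := by exact_mod_cast hbr
  have hsl' : (s : ℝ) ≤ l := by exact_mod_cast hsl
  have hre' : (r : ℝ) ≤ e := by exact_mod_cast hre
  have hm := h.tol_le_of_large hG (le_min (by linarith) (by linarith)) hM
    (h.abs_cusum_le hs he (by omega) hi' hen hsl hlb hbr hre hG.le hk₀max)
  rw [le_min_iff] at hm
  -- the split point is close to an end of its stretch
  obtain ⟨k, hkq, hkb, hbk⟩ := h.model.exists_between (b := b) (by omega)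
  have index : ∀ j ≤ q + 1, |(b : ℝ) - θ j| ≤ tol c q * n / 4 → j ∈ Finset.Ioo i i' :=
    fun j hj hb => h.index_mem hs he (by omega) hj (by linarith) (by linarith) hb
  rcases hkb.eq_or_lt with hkb | hkb
  · refine ⟨k, index k (by omega) ?_, ?_⟩
    · rw [hkb, sub_self, abs_zero]; linarith
    · rw [← hkb]; exact h.near_self k
  have hu : max l (θ k) < b := max_lt hlb hkb
  have hv : b < min r (θ (k + 1)) := lt_min hbr hbk
  have hu' : ((max l (θ k) : ℕ) : ℝ) < b := by exact_mod_cast hu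
  have hv' : (b : ℝ) < ((min r (θ (k + 1)) : ℕ) : ℝ) := by exact_mod_cast hv
  have hgap := h.gap_succ k hkq
  -- If an end of the stretch is l or r, the distance to it is already large. If both are change
  -- points, the stretch has length at least c n, more than twice the tolerance.
  have hρ : tol c q * n ≤ max ((b : ℝ) - (max l (θ k) : ℕ)) (((min r (θ (k + 1)) : ℕ) : ℝ) - b) := by
    rcases le_total l (θ k) with h1 | h1
    · rcases le_total r (θ (k + 1)) with h2 | h2
      · rw [min_eq_left h2]; exact le_max_of_le_right hm.2
      · rw [max_eq_right h1, min_eq_right h2]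
        by_contra hcon
        rw [not_le, max_lt_iff] at hcon
        linarith
    · rw [max_eq_left h1]; exact le_max_of_le_left hm.1
  have hend := maximiser_near_end (x := x) h.noise hζ (le_max_left l (θ k)) hu hv
    (min_le_left _ _) (hre.trans hen) (φ := level f' f₀ k) (fun t ht => by
      rw [Finset.mem_Ioc, max_lt_iff, le_min_iff] at ht
      exact h.data_eq_level hkq ht.1.2 ht.2.2) hmax hρ
  set u := (b : ℝ) - (max l (θ k) : ℕ) with hudef
  set v := ((min r (θ (k + 1)) : ℕ) : ℝ) - b with hvdef
  have huv : 0 < min u v := lt_min (by linarith) (by linarith)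
  have hloc : G * Real.sqrt (min u v) ≤ locConst c q * ζ := by
    have h1 : c * (G * Real.sqrt n) / 8 * Real.sqrt (min u v) * (tol c q * n)
        ≤ 2 * ζ * (n * Real.sqrt n) := by
      refine le_trans ?_ hend
      have h0 := mul_nonneg (two_le_threshConst h.c_pos h.q_pos |>.trans' zero_le_two) hζ
      have : c * (G * Real.sqrt n) / 8 ≤ |cusum x l b r| := by linarith
      gcongr
    have h2 : (n * Real.sqrt n) * (c * tol c q * (G * Real.sqrt (min u v)))
        ≤ (n * Real.sqrt n) * (16 * ζ) := by linarith
    have h3 := le_of_mul_le_mul_left h2 (by positivity)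
    rw [locConst, div_mul_eq_mul_div, le_div_iff₀ (by positivity)]
    linarith
  -- The choice of `snrConst` gives q·`locConst`·ζ ≤ c G√n/32. Hence √(min u v) is at most half the
  -- square root of `tol`·n.
  have hsmall : min u v ≤ tol c q * n / 4 := by
    have hq : (0 : ℝ) < q := by exact_mod_cast h.q_pos
    have h1 := h.thresh_le hsnr
    have h2 : q * (locConst c q * ζ) ≤ threshConst c q * ζ := by
      unfold threshConst
      linarith
    have h3 : G * (q * Real.sqrt (min u v)) ≤ G * (c * Real.sqrt n / 32) := by
      have := mul_le_mul_of_nonneg_left hloc hq.le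
      linarith
    have h4 := le_of_mul_le_mul_left h3 hG
    have h5 : Real.sqrt (min u v) ≤ c / (16 * q) * Real.sqrt n / 2 := by
      refine le_of_mul_le_mul_left (h4.trans_eq ?_) hq
      field_simp
      norm_num
    have h6 := pow_le_pow_left₀ (Real.sqrt_nonneg _) h5 2
    rw [Real.sq_sqrt huv.le, div_pow, mul_pow, Real.sq_sqrt hn.le] at h6
    unfold tol
    linarith
  have fin : ∀ j ≤ q + 1, |(b : ℝ) - θ j| = min u v →
      ∃ k ∈ Finset.Ioo i i', IsNear c q n θ f' ζ b k := by
    intro j hj hb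
    have hmem := index j hj (hb.le.trans hsmall)
    refine ⟨j, hmem, hb.le.trans hsmall, ?_⟩
    rw [hb]
    exact (mul_le_mul_of_nonneg_right (hk₀max j hmem) (Real.sqrt_nonneg _)).trans hloc
  -- The nearer end of the stretch must be a change point: l and r are a full tolerance away from b.
  rcases min_cases u v with ⟨h1, _⟩ | ⟨h1, _⟩
  · rcases le_total l (θ k) with h2 | h2
    · refine fin k (by omega) ?_
      rw [h1, hudef, max_eq_right h2, abs_of_nonneg]
      rw [max_eq_right h2] at hu'
      linarith
    · rw [h1, hudef, max_eq_left h2] at hsmall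
      linarith
  · rcases le_total r (θ (k + 1)) with h2 | h2
    · rw [h1, hvdef, min_eq_left h2] at hsmall
      linarith
    · refine fin (k + 1) (by omega) ?_
      rw [h1, hvdef, min_eq_right h2, abs_sub_comm, abs_of_nonneg]
      rw [min_eq_right h2] at hv'
      linarith

end Deterministic

/-! ### The recursion -/

lemma mem_sampledIntervals_bounds {R s e : ℕ} {p : ℕ × ℕ} (h : p ∈ sampledIntervals R s e) :
    s ≤ p.1 ∧ p.1 + 1 < p.2 ∧ p.2 ≤ e := by
  have : p ∈ allIntervals s e := by
    unfold sampledIntervals at h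
    split_ifs at h
    · exact h
    · exact (Finset.mem_filter.1 h).1
  simp only [allIntervals, Finset.mem_filter, Finset.mem_product, Finset.mem_Icc] at this
  omega

lemma two_le_gridSize {R : ℕ} (hR : 1 ≤ R) : 2 ≤ gridSize R := by
  have hne : {K : ℕ | R ≤ K.choose 2}.Nonempty := by
    refine ⟨R + 1, ?_⟩
    simp only [Set.mem_ofPred_eq, Nat.choose_succ_succ' R 1, Nat.choose_one_right]
    omega
  have h : R ≤ (gridSize R).choose 2 := Nat.sInf_mem hne
  by_contra hcon
  rw [Nat.choose_eq_zero_of_lt (by omega)] at h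
  omega

/-- The whole interval is always examined. -/
lemma self_mem_sampledIntervals {R s e : ℕ} (hR : 1 ≤ R) (h : s + 1 < e) :
    (s, e) ∈ sampledIntervals R s e := by
  have hall : (s, e) ∈ allIntervals s e := by
    simp only [allIntervals, Finset.mem_filter, Finset.mem_product, Finset.mem_Icc]
    omega
  unfold sampledIntervals
  split_ifs
  · exact hall
  · have hK := two_le_gridSize hR
    have hK' : ((gridSize R : ℕ) : ℚ) - 1 ≠ 0 := by
      have : (2 : ℚ) ≤ (gridSize R : ℕ) := by exact_mod_cast hK
      linarith
    refine Finset.mem_filter.2 ⟨hall, Finset.mem_image.2 ⟨1, Finset.mem_Icc.2 ⟨le_rfl, by omega⟩, ?_⟩,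
      Finset.mem_image.2 ⟨gridSize R, Finset.mem_Icc.2 ⟨by omega, le_rfl⟩, ?_⟩⟩
    -- The first and last grid points are s and e exactly, so rounding leaves them unchanged.
    · rw [show ((e : ℚ) - s) / ((gridSize R : ℕ) - 1) * ((1 : ℕ) : ℚ) + s
        - ((e : ℚ) - s) / ((gridSize R : ℕ) - 1) = s by push_cast; ring, round_natCast,
        Int.toNat_natCast]
    · rw [show ((e : ℚ) - s) / ((gridSize R : ℕ) - 1) * (gridSize R : ℕ) + s
        - ((e : ℚ) - s) / ((gridSize R : ℕ) - 1) = e by field_simp; ring, round_natCast,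
        Int.toNat_natCast]

lemma exists_isMaxEnergySplit (x : ℕ → ℝ) {R s e : ℕ} (hR : 1 ≤ R) (h : s + 1 < e) :
    ∃ l b r, IsMaxEnergySplit x R s e l b r := by
  have hself := self_mem_sampledIntervals hR h
  obtain ⟨⟨⟨l, r⟩, b⟩, hmem, hmax⟩ := Finset.exists_max_image
    ((sampledIntervals R s e ×ˢ Finset.Icc s e).filter fun p => p.1.1 < p.2 ∧ p.2 < p.1.2)
    (fun p => |cusum x p.1.1 p.2 p.1.2|)
    ⟨((s, e), s + 1), by
      simp only [Finset.mem_filter, Finset.mem_product, Finset.mem_Icc]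
      exact ⟨⟨hself, by omega, by omega⟩, by omega, h⟩⟩
  simp only [Finset.mem_filter, Finset.mem_product] at hmem
  refine ⟨l, b, r, ⟨hmem.1.1, hmem.2⟩, fun l' b' r' h1 h2 h3 => hmax ((l', r'), b') ?_⟩
  have := mem_sampledIntervals_bounds h1
  simp only [Finset.mem_filter, Finset.mem_product, Finset.mem_Icc]
  simp only at this
  exact ⟨⟨h1, by omega, by omega⟩, h2, h3⟩

lemma exists_isWBS2 (x : ℕ → ℝ) {R : ℕ} (hR : 1 ≤ R) (s e : ℕ) : ∃ P, IsWBS2 x R s e P := by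
  induction hd : e - s using Nat.strong_induction_on generalizing s e with
  | _ d ih =>
    rcases le_or_gt e (s + 1) with h | h
    · exact ⟨∅, IsWBS2.base s e h⟩
    · obtain ⟨l, b, r, hmax⟩ := exists_isMaxEnergySplit x hR h
      have hb := mem_sampledIntervals_bounds hmax.1.1
      have hb' := hmax.1.2
      simp only at hb
      obtain ⟨P₁, h₁⟩ := ih (b - s) (by omega) s b rfl
      obtain ⟨P₂, h₂⟩ := ih (e - b) (by omega) b e rfl
      exact ⟨_, IsWBS2.split s e l b r P₁ P₂ h hmax h₁ h₂⟩

lemma IsWBS2.bounds {x : ℕ → ℝ} {R s e : ℕ} {P : Finset (ℕ × ℕ × ℕ)} (h : IsWBS2 x R s e P) :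
    ∀ p ∈ P, s ≤ p.1 ∧ p.1 < p.2.1 ∧ p.2.1 < p.2.2 ∧ p.2.2 ≤ e := by
  induction h with
  | base => simp
  | split s e l b r P₁ P₂ h hmax _ _ ih₁ ih₂ =>
    intro p hp
    have hb := mem_sampledIntervals_bounds hmax.1.1
    have hb' := hmax.1.2
    simp only at hb
    rw [Finset.mem_insert, Finset.mem_union] at hp
    rcases hp with rfl | hp | hp
    · simp only; omega
    · have := ih₁ p hp; omega
    · have := ih₂ p hp; omega

lemma exists_isSolutionPath (x : ℕ → ℝ) (P : Finset (ℕ × ℕ × ℕ)) :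
    ∃ path, IsSolutionPath x P path := by
  classical
  let rel : ℕ × ℕ × ℕ → ℕ × ℕ × ℕ → Prop := fun p p' => maxCusum x p' ≤ maxCusum x p
  have : Std.Total rel := ⟨fun a b => le_total _ _⟩
  have : IsTrans _ rel := ⟨fun a b c hab hbc => le_trans hbc hab⟩
  refine ⟨(P.filter fun p => 0 < maxCusum x p).toList.insertionSort rel, ?_, fun p => ?_, ?_⟩
  · exact (List.perm_insertionSort rel _).nodup_iff.2 (Finset.nodup_toList _)
  · rw [(List.perm_insertionSort rel _).mem_iff, Finset.mem_toList, Finset.mem_filter]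
  · exact List.pairwise_insertionSort rel _

lemma exists_isCusumArgmax (x : ℕ → ℝ) {l r : ℕ} (h : l + 1 < r) : ∃ b, IsCusumArgmax x l r b := by
  obtain ⟨b, hb, hmax⟩ := Finset.exists_max_image (Finset.Ioo l r) (fun b => |cusum x l b r|)
    ⟨l + 1, Finset.mem_Ioo.2 ⟨by omega, h⟩⟩
  exact ⟨b, Finset.mem_Ioo.1 hb, fun c h1 h2 => hmax c (Finset.mem_Ioo.2 ⟨h1, h2⟩)⟩

/-! ### The largest entries of the solution path -/

/-- Once an entry fails to exceed τ, so do all later ones. -/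
lemma filter_eq_take_of_pairwise {α : Type*} (m : α → ℝ) (τ : ℝ) (L : List α)
    (h : L.Pairwise fun p p' => m p' ≤ m p) :
    L.filter (fun p => decide (τ < m p)) =
      L.take (L.filter (fun p => decide (τ < m p))).length := by
  induction L with
  | nil => simp
  | cons a L ih =>
    rw [List.pairwise_cons] at h
    by_cases ha : τ < m a
    · rw [List.filter_cons_of_pos (by simpa using ha), List.length_cons, List.take_succ_cons,
        ← ih h.2]
    · have : L.filter (fun p => decide (τ < m p)) = [] := by
        rw [List.filter_eq_nil_iff]
        intro p hp
        simpa using (h.1 p hp).trans (not_lt.1 ha)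
      rw [List.filter_cons_of_neg (by simpa using ha), this]
      simp

/-- At the first disagreement, the smaller of the two values must occur in the other enumeration at
an earlier index, where both agree. This contradicts strict monotonicity. -/
lemma eq_of_strictMonoOn_of_image_eq {q : ℕ} {f g : ℕ → ℕ} (hf : StrictMonoOn f (Set.Icc 1 q))
    (hg : StrictMonoOn g (Set.Icc 1 q))
    (hfg : (Finset.Icc 1 q).image f = (Finset.Icc 1 q).image g) :
    ∀ k ∈ Set.Icc 1 q, f k = g k := by
  intro k
  induction k using Nat.strong_induction_on with
  | _ k ih =>
    intro hk
    have aux : ∀ f g : ℕ → ℕ, StrictMonoOn f (Set.Icc 1 q) → StrictMonoOn g (Set.Icc 1 q) →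
        (Finset.Icc 1 q).image f = (Finset.Icc 1 q).image g →
        (∀ m < k, m ∈ Set.Icc 1 q → f m = g m) → ¬ f k < g k := by
      intro f g hf hg hfg ih hlt
      have hmem : f k ∈ (Finset.Icc 1 q).image g := by
        rw [← hfg]
        exact Finset.mem_image_of_mem f (Finset.mem_Icc.2 hk)
      obtain ⟨j, hj, hjk⟩ := Finset.mem_image.1 hmem
      have hj' : j ∈ Set.Icc 1 q := Finset.mem_Icc.1 hj
      have hjlt : j < k := (hg.lt_iff_lt hj' hk).1 (by omega)
      have := hf hj' hk hjlt
      rw [ih j hjlt hj'] at this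
      omega
    exact le_antisymm
      (not_lt.1 (aux g f hg hf hfg.symm fun m h1 h2 => (ih m h1 h2).symm))
      (not_lt.1 (aux f g hf hg hfg ih))

section Deterministic

variable {c : ℝ} {q n R : ℕ} {θ : ℕ → ℕ} {f' : ℕ → ℝ} {f₀ : ℝ} {x z : ℕ → ℝ} {ζ : ℝ}

/-- The large entries produced by the recursion correspond to the change points. -/
lemma Regime.exists_large_entries (h : Regime c q n θ f' f₀ x z ζ) (hR : 1 ≤ R) {s e : ℕ}
    {P : Finset (ℕ × ℕ × ℕ)} (hP : IsWBS2 x R s e P) : ∀ i i', e ≤ n →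
    IsNear c q n θ f' ζ s i → IsNear c q n θ f' ζ e i' → i < i' → i' ≤ q + 1 →
    ∃ p : ℕ → ℕ × ℕ × ℕ, (∀ k ∈ Finset.Ioo i i', p k ∈ P ∧
        threshConst c q * ζ < maxCusum x (p k) ∧ IsNear c q n θ f' ζ (p k).2.1 k) ∧
      ∀ p' ∈ P, threshConst c q * ζ < maxCusum x p' → ∃ k ∈ Finset.Ioo i i', p' = p k := by
  induction hP with
  | base s e hse =>
    intro i i' hen hs he hii hi'
    refine ⟨fun _ => 0, fun k hk => ?_, by simp⟩
    rw [Finset.mem_Ioo] at hk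
    have h1 := h.lt_of_near_right hs hk.1 (by omega)
    have h2 := h.lt_of_near_left he hk.2 hi'
    omega
  | split s e l b r P₁ P₂ hse hmax h₁ h₂ ih₁ ih₂ =>
    intro i i' hen hs he hii hi'
    have hwhole := (IsWBS2.split s e l b r P₁ P₂ hse hmax h₁ h₂).bounds
    have hb := mem_sampledIntervals_bounds hmax.1.1
    have hb' := hmax.1.2
    simp only at hb
    rcases Nat.eq_or_lt_of_le (Nat.succ_le_of_lt hii) with hi1 | hi1
    · subst hi1
      -- No index lies strictly between i and i + 1, so the family p is arbitrary. The split chosen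
      -- here is uncontrolled, but all entries of this subtree stay below the threshold.
      refine ⟨fun _ => 0, fun k hk => ?_, fun p' hp' hlt => ?_⟩
      · rw [Finset.mem_Ioo] at hk; omega
      · obtain ⟨a1, a2, a3, a4⟩ := hwhole p' hp'
        exact absurd hlt (not_lt.2 (h.abs_cusum_le_thresh hs he (by omega) hen a1 a2 a3 a4))
    · obtain ⟨⟨k, hk, hbk⟩, hlarge⟩ := h.exists_near_of_max hs he hi1 hi' hen hb.1 hb'.1 hb'.2
        hb.2.2 (fun y h1 h2 => hmax.2 l y r hmax.1.1 h1 h2)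
        (fun y h1 h2 => hmax.2 s y e (self_mem_sampledIntervals hR hse) h1 h2)
      rw [Finset.mem_Ioo] at hk
      obtain ⟨p₁, hp₁, hp₁'⟩ := ih₁ i k (by omega) hs hbk hk.1 (by omega)
      obtain ⟨p₂, hp₂, hp₂'⟩ := ih₂ k i' hen hbk he hk.2 hi'
      refine ⟨fun j => if j < k then p₁ j else if j = k then (l, b, r) else p₂ j, ?_, ?_⟩
      · intro j hj
        rw [Finset.mem_Ioo] at hj
        rcases lt_trichotomy j k with hjk | hjk | hjk
        · obtain ⟨a1, a2⟩ := hp₁ j (Finset.mem_Ioo.2 ⟨hj.1, hjk⟩)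
          simp only [if_pos hjk]
          exact ⟨Finset.mem_insert_of_mem (Finset.mem_union_left _ a1), a2⟩
        · subst hjk
          simp only [lt_irrefl, if_false, if_true]
          exact ⟨Finset.mem_insert_self _ _, hlarge, hbk⟩
        · obtain ⟨a1, a2⟩ := hp₂ j (Finset.mem_Ioo.2 ⟨hjk, hj.2⟩)
          simp only [if_neg (show ¬ j < k by omega), if_neg (show ¬ j = k by omega)]
          exact ⟨Finset.mem_insert_of_mem (Finset.mem_union_right _ a1), a2⟩
      · intro p' hp' hlt
        rw [Finset.mem_insert, Finset.mem_union] at hp'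
        rcases hp' with rfl | hp' | hp'
        · exact ⟨k, Finset.mem_Ioo.2 hk, by simp⟩
        · obtain ⟨j, hj, hpj⟩ := hp₁' p' hp' hlt
          rw [Finset.mem_Ioo] at hj
          exact ⟨j, Finset.mem_Ioo.2 ⟨hj.1, by omega⟩, by simpa only [if_pos hj.2] using hpj⟩
        · obtain ⟨j, hj, hpj⟩ := hp₂' p' hp' hlt
          rw [Finset.mem_Ioo] at hj
          exact ⟨j, Finset.mem_Ioo.2 ⟨by omega, hj.2⟩,
            by simpa only [if_neg (show ¬ j < k by omega), if_neg (show ¬ j = k by omega)] using hpj⟩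

lemma Regime.lt_of_near (h : Regime c q n θ f' f₀ x z ζ) {a b i j : ℕ}
    (ha : IsNear c q n θ f' ζ a i) (hb : IsNear c q n θ f' ζ b j) (hij : i < j)
    (hj : j ≤ q + 1) : a < b := by
  have h1 := h.gap hij hj
  have h2 := (abs_le.1 ha.1).2
  have h3 := (abs_le.1 hb.1).1
  have h4 := h.tol_mul_pos
  have h5 := h.tol_mul_le
  exact_mod_cast show (a : ℝ) < b by linarith

/-- The `q` entries at the top of the path, listed by their split points. -/
lemma Regime.exists_top_entries (h : Regime c q n θ f' f₀ x z ζ) (hR : 1 ≤ R)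
    {P : Finset (ℕ × ℕ × ℕ)} {path : List (ℕ × ℕ × ℕ)} (hP : IsWBS2 x R 0 n P)
    (hpath : IsSolutionPath x P path) :
    ∃ b : ℕ → ℕ, (∀ k ∈ Finset.Icc 1 q, IsNear c q n θ f' ζ (b k) k) ∧
      IsTopEstimate q path b := by
  -- The values of f' at 0 and q + 1 are meaningless, which is harmless because they multiply the
  -- distance zero.
  have hs : IsNear c q n θ f' ζ 0 0 := by simpa [h.model.first] using h.near_self 0
  have he : IsNear c q n θ f' ζ n (q + 1) := by
    have := h.near_self (q + 1)
    rwa [h.model.last] at this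
  obtain ⟨p, hp, hp'⟩ := h.exists_large_entries hR hP 0 (q + 1) le_rfl hs he (by omega) le_rfl
  have hIoo : Finset.Ioo 0 (q + 1) = Finset.Icc 1 q := by
    ext j; simp only [Finset.mem_Ioo, Finset.mem_Icc]; omega
  rw [hIoo] at hp hp'
  -- Nonnegativity ensures that discarding entries with zero CUSUM loses none above the threshold.
  have hτ : 0 ≤ threshConst c q * ζ :=
    mul_nonneg (zero_le_two.trans (two_le_threshConst h.c_pos h.q_pos)) h.level_nonneg
  have hmono : StrictMonoOn (fun k => (p k).2.1) (Set.Icc 1 q) := by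
    intro i hi j hj hij
    exact h.lt_of_near (hp i (Finset.mem_Icc.2 hi)).2.2 (hp j (Finset.mem_Icc.2 hj)).2.2 hij
      (hj.2.trans (Nat.le_succ q))
  have hinj : Set.InjOn p (Finset.Icc 1 q : Finset ℕ) := fun i hi j hj hij =>
    hmono.injOn (Finset.mem_Icc.1 hi) (Finset.mem_Icc.1 hj) (by simp only [hij])
  set F := path.filter fun p => decide (threshConst c q * ζ < maxCusum x p) with hF
  have hFset : F.toFinset = (Finset.Icc 1 q).image p := by
    ext t
    rw [List.mem_toFinset, hF, List.mem_filter, hpath.2.1, Finset.mem_image, decide_eq_true_iff]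
    constructor
    · rintro ⟨⟨h1, -⟩, h2⟩
      obtain ⟨k, hk, rfl⟩ := hp' t h1 h2
      exact ⟨k, hk, rfl⟩
    · rintro ⟨k, hk, rfl⟩
      exact ⟨⟨(hp k hk).1, hτ.trans_lt (hp k hk).2.1⟩, (hp k hk).2.1⟩
  have hFlen : F.length = q := by
    rw [← List.toFinset_card_of_nodup (hpath.1.filter _), hFset, Finset.card_image_of_injOn hinj,
      Nat.card_Icc, Nat.add_sub_cancel]
  have htake : F = path.take q := by
    have := filter_eq_take_of_pairwise (maxCusum x) (threshConst c q * ζ) path hpath.2.2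
    rwa [← hF, hFlen] at this
  refine ⟨fun k => (p k).2.1, fun k hk => (hp k hk).2.2, ?_, hmono, ?_⟩
  · rw [← hFlen]; exact List.length_filter_le _ _
  · rw [← htake]
    ext t
    simp only [Finset.mem_image, List.mem_toFinset, List.mem_map]
    simp only [← List.mem_toFinset, hFset, Finset.mem_image, exists_exists_and_eq_and]

lemma Regime.near_of_isTopEstimate (h : Regime c q n θ f' f₀ x z ζ) (hR : 1 ≤ R)
    {P : Finset (ℕ × ℕ × ℕ)} {path : List (ℕ × ℕ × ℕ)} (hP : IsWBS2 x R 0 n P)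
    (hpath : IsSolutionPath x P path) {θhat : ℕ → ℕ} (hθ : IsTopEstimate q path θhat) :
    ∀ k ∈ Finset.Icc 1 q, IsNear c q n θ f' ζ (θhat k) k := by
  obtain ⟨b, hb, htop⟩ := h.exists_top_entries hR hP hpath
  intro k hk
  rw [eq_of_strictMonoOn_of_image_eq hθ.2.1 htop.2.1 (hθ.2.2.trans htop.2.2.symm) k
    (Finset.mem_Icc.1 hk)]
  exact hb k hk

end Deterministic

/-! ### The refinement -/

section Deterministic

variable {c : ℝ} {q n R : ℕ} {θ : ℕ → ℕ} {f' : ℕ → ℝ} {f₀ : ℝ} {x z : ℕ → ℝ} {ζ : ℝ}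

lemma Regime.refineLeft_bounds (h : Regime c q n θ f' f₀ x z ζ) {θhat : ℕ → ℕ}
    (hθ : ∀ k ∈ Finset.Icc 1 q, IsNear c q n θ f' ζ (θhat k) k) {j : ℕ}
    (hj : j ∈ Finset.Icc 1 q) :
    θ (j - 1) ≤ refineLeft θhat j ∧ c * n / 2 ≤ (θ j : ℝ) - refineLeft θhat j := by
  rw [Finset.mem_Icc] at hj
  have hcn := h.tol_mul_le
  have hpos := h.tol_mul_pos
  have hgap := h.gap (show j - 1 < j by omega) (by omega)
  unfold refineLeft
  split_ifs with h1
  · subst h1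
    rw [Nat.sub_self, h.model.first] at *
    push_cast at hgap ⊢
    exact ⟨by simp, by linarith⟩
  · have ha := abs_le.1 (hθ (j - 1) (Finset.mem_Icc.2 ⟨by omega, by omega⟩)).1
    have hb := abs_le.1 (hθ j (Finset.mem_Icc.2 hj)).1
    have e1 : 3 * ((2 * θhat (j - 1) + θhat j) / 3) ≤ 2 * θhat (j - 1) + θhat j := by omega
    have e2 : 2 * θhat (j - 1) + θhat j ≤ 3 * ((2 * θhat (j - 1) + θhat j) / 3) + 2 := by omega
    generalize (2 * θhat (j - 1) + θhat j) / 3 = ℓ at e1 e2 ⊢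
    have e1' : 3 * (ℓ : ℝ) ≤ 2 * θhat (j - 1) + θhat j := by exact_mod_cast e1
    have e2' : 2 * (θhat (j - 1) : ℝ) + θhat j ≤ 3 * ℓ + 2 := by exact_mod_cast e2
    -- Rounding down costs less than one, so it suffices to compare with ℓ + 1 in the reals and
    -- return to integers.
    constructor
    · have : (θ (j - 1) : ℝ) < ℓ + 1 := by linarith
      exact Nat.lt_succ_iff.1 (by exact_mod_cast this)
    · linarith

/-- Rounding down moves the right end towards the j-th change point. The slack c n/2 in three times
the distance must absorb a loss of 2 and the localisation errors, and c n ≥ 5 is enough. -/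
lemma Regime.refineRight_bounds (h : Regime c q n θ f' f₀ x z ζ) (hcn5 : 5 ≤ c * n)
    {θhat : ℕ → ℕ} (hθ : ∀ k ∈ Finset.Icc 1 q, IsNear c q n θ f' ζ (θhat k) k) {j : ℕ}
    (hj : j ∈ Finset.Icc 1 q) :
    refineRight q n θhat j ≤ θ (j + 1) ∧ c * n / 2 ≤ (refineRight q n θhat j : ℝ) - θ j := by
  rw [Finset.mem_Icc] at hj
  have hcn := h.tol_mul_le
  have hpos := h.tol_mul_pos
  have hgap := h.gap_succ j hj.2
  unfold refineRight
  split_ifs with h1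
  · subst h1
    rw [h.model.last] at *
    exact ⟨le_rfl, by linarith⟩
  · have ha := abs_le.1 (hθ (j + 1) (Finset.mem_Icc.2 ⟨by omega, by omega⟩)).1
    have hb := abs_le.1 (hθ j (Finset.mem_Icc.2 hj)).1
    have e1 : 3 * ((θhat j + 2 * θhat (j + 1)) / 3) ≤ θhat j + 2 * θhat (j + 1) := by omega
    have e2 : θhat j + 2 * θhat (j + 1) ≤ 3 * ((θhat j + 2 * θhat (j + 1)) / 3) + 2 := by omega
    generalize (θhat j + 2 * θhat (j + 1)) / 3 = r at e1 e2 ⊢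
    have e1' : 3 * (r : ℝ) ≤ θhat j + 2 * θhat (j + 1) := by exact_mod_cast e1
    have e2' : (θhat j : ℝ) + 2 * θhat (j + 1) ≤ 3 * r + 2 := by exact_mod_cast e2
    constructor
    · exact_mod_cast show (r : ℝ) ≤ θ (j + 1) by linarith
    · linarith

/-- The CUSUM maximiser on an interval isolating one change point, under a bound on the noise
averages around this change point. -/
lemma Regime.abs_argmax_sub_le (h : Regime c q n θ f' f₀ x z ζ) {j l r b : ℕ} {κ H : ℝ}
    (hj : j ∈ Finset.Icc 1 q) (hl : θ (j - 1) ≤ l) (hr : r ≤ θ (j + 1))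
    (hlθ : c * n / 2 ≤ (θ j : ℝ) - l) (hθr : c * n / 2 ≤ (r : ℝ) - θ j)
    (hb : IsCusumArgmax x l r b) (hκ : 0 ≤ κ)
    (hH : 24 * H < c * tol c q * |f' j|)
    (hleft : ∀ k : ℕ, κ ≤ k → k ≤ θ j - θ (j - 1) →
      |∑ t ∈ Finset.Ioc (θ j - k) (θ j), z t| ≤ H * k)
    (hright : ∀ k : ℕ, κ ≤ k → k ≤ θ (j + 1) - θ j →
      |∑ t ∈ Finset.Ioc (θ j) (θ j + k), z t| ≤ H * k) :
    |(b : ℝ) - θ j| ≤ κ := by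
  obtain ⟨⟨hlb, hbr⟩, hmax⟩ := hb
  have hc := h.c_pos
  have hζ := h.level_nonneg
  have hn : (0 : ℝ) < n := by exact_mod_cast h.n_pos
  have hsn := Real.sqrt_pos.2 hn
  have hcn : 0 < c * n := mul_pos hc hn
  have hG : 0 < |f' j| := abs_pos.2 (h.model.jump_ne _ hj)
  have hsnr := h.snr _ hj
  obtain ⟨hj1, hjq⟩ := Finset.mem_Icc.1 hj
  obtain ⟨p, rfl⟩ : ∃ p, j = p + 1 := ⟨j - 1, by omega⟩
  rw [Nat.add_sub_cancel] at hl hleft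
  have hlθ' : l < θ (p + 1) := by exact_mod_cast show (l : ℝ) < θ (p + 1) by linarith
  have hθr' : θ (p + 1) < r := by exact_mod_cast show (θ (p + 1) : ℝ) < r by linarith
  have hrn : r ≤ n := hr.trans (h.le_n (by omega))
  have hlb' : (l : ℝ) < b := by exact_mod_cast hlb
  have hbr' : (b : ℝ) < r := by exact_mod_cast hbr
  have hrn' : (r : ℝ) ≤ n := by exact_mod_cast hrn
  have hl0 : (0 : ℝ) ≤ l := Nat.cast_nonneg l
  have hM : threshConst c q * ζ + c * (|f' (p + 1)| * Real.sqrt n) / 8 ≤ |cusum x l b r| := by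
    refine h.large hsnr ?_
    have hjump := jump_le_of_abs_cusum_le (x := x) (l := l) (r := r) (c := l)
      (b := θ (p + 1)) (d := r) (m := c * n / 2) (φ₁ := level f' f₀ p)
      (φ₂ := level f' f₀ (p + 1)) h.noise hζ le_rfl hlθ' hθr' le_rfl hrn
      (fun t ht => ?_) (fun t ht => ?_) hlθ hθr hmax
    · rwa [level_succ, sub_add_cancel_left, abs_neg] at hjump
    · rw [Finset.mem_Ioc] at ht
      exact h.data_eq_level (by omega) (by omega) ht.2
    · rw [Finset.mem_Ioc] at ht
      exact h.data_eq_level hjq ht.1 (by omega)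
  have hm : tol c q * n ≤ min ((b : ℝ) - l) ((r : ℝ) - b) := by
    have hB := mul_nonneg (locConst_pos h.c_pos h.q_pos).le hζ
    have hGm : 0 ≤ |f' (p + 1)| * Real.sqrt (min ((b : ℝ) - l) ((r : ℝ) - b)) := by positivity
    refine h.tol_le_of_large hG (le_min (by linarith) (by linarith)) hM
      (abs_cusum_le_sum h.data h.noise hlb hbr hrn fun i hi => ?_)
    rw [Finset.mem_Icc] at hi
    rcases lt_trichotomy i (p + 1) with hip | rfl | hip
    · have h1 := h.model.mono (show i ≤ p by omega) (by omega)
      have h2 : (θ i : ℝ) ≤ l := by exact_mod_cast h1.trans hl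
      have h3 := abs_cusum_step_le_left (θ i) hlb hbr
      rw [max_eq_left (by linarith), Real.sqrt_zero] at h3
      have := mul_le_mul_of_nonneg_left h3 (abs_nonneg (f' i))
      linarith
    · have := mul_le_mul_of_nonneg_left (abs_cusum_step_le_min (θ (p + 1)) hlb hbr) hG.le
      linarith
    · have h1 := h.model.mono (show p + 1 + 1 ≤ i by omega) (by omega)
      have h2 : (r : ℝ) ≤ θ i := by exact_mod_cast hr.trans h1
      have h3 := abs_cusum_step_le_right (θ i) hlb hbr
      rw [max_eq_left (by linarith), Real.sqrt_zero] at h3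
      have := mul_le_mul_of_nonneg_left h3 (abs_nonneg (f' i))
      linarith
  rw [le_min_iff] at hm
  have hM' : c * (|f' (p + 1)| * Real.sqrt n) / 8 ≤ |cusum x l b r| := by
    have := mul_nonneg (zero_le_two.trans (two_le_threshConst h.c_pos h.q_pos)) hζ
    linarith
  have hK : 2 * ((r : ℝ) - l) * Real.sqrt (weight l r b) ≤ n * Real.sqrt n := by
    have := sqrt_weight_le (l := l) (r := r) (b := b) (N := n) hlb.le hbr.le (by linarith)
    calc 2 * ((r : ℝ) - l) * Real.sqrt (weight l r b) ≤ 2 * n * (Real.sqrt n / 2) :=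
        mul_le_mul (by linarith) this (Real.sqrt_nonneg _) (by positivity)
      _ = _ := by ring
  -- Here v is the distance from b to the change point, u that to the end of the interval on the
  -- same side as b, and T the noise contrast. Cancelling v(u + v) bounds CUSUM·u by 3H n√n. The
  -- lower bounds c|f'|√n/8 and `tol`·n then contradict `hH`, which explains the factor 24.
  have key : ∀ u v T : ℝ, 0 < v → tol c q * n ≤ u → T ≤ 3 * H * (v * (u + v)) →
      |cusum x l b r| * (u * v * (u + v)) ≤ n * Real.sqrt n * T → False := by
    intro u v T hv hu hT hle
    have hε := h.tol_mul_pos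
    have hu0 : 0 < u := hε.trans_le hu
    have h1 : v * (u + v) * (|cusum x l b r| * u) ≤
        v * (u + v) * (n * Real.sqrt n * (3 * H)) := by
      have := mul_le_mul_of_nonneg_left hT (show 0 ≤ n * Real.sqrt n by positivity)
      linarith
    have h2 := le_of_mul_le_mul_left h1 (by positivity)
    have h3 := mul_le_mul hM' hu hε.le (abs_nonneg _)
    have h4 : n * Real.sqrt n * (c * tol c q * |f' (p + 1)|) ≤ n * Real.sqrt n * (24 * H) := by
      linarith
    exact absurd (le_of_mul_le_mul_left h4 (by positivity)) (not_le.2 hH)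
  by_contra hcon
  rw [not_le] at hcon
  rcases lt_or_ge b (θ (p + 1)) with hbθ | hbθ
  · have hbθ' : (b : ℝ) < θ (p + 1) := by exact_mod_cast hbθ
    rw [abs_of_neg (by linarith), neg_sub] at hcon
    have s1 := hleft (θ (p + 1) - b) (by rw [Nat.cast_sub hbθ.le]; exact hcon.le) (by omega)
    have s2 := hleft (θ (p + 1) - l) (by rw [Nat.cast_sub hlθ'.le]; linarith) (by omega)
    rw [Nat.cast_sub hbθ.le, Nat.sub_sub_self hbθ.le] at s1
    rw [Nat.cast_sub hlθ'.le, Nat.sub_sub_self hlθ'.le] at s2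
    -- The local bound covers only sums ending at the change point, so the sum over (l, b] is
    -- written as a difference of two of these, both longer than κ.
    have s3 : |∑ t ∈ Finset.Ioc l b, z t| ≤ H * ((θ (p + 1) : ℝ) - l)
        + H * ((θ (p + 1) : ℝ) - b) := by
      rw [← sum_Ioc_add hlb.le hbθ.le] at s2
      have := abs_sub (∑ t ∈ Finset.Ioc l b, z t + ∑ t ∈ Finset.Ioc b (θ (p + 1)), z t)
        (∑ t ∈ Finset.Ioc b (θ (p + 1)), z t)
      rw [add_sub_cancel_right] at this
      linarith
    have hgap := weight_mul_gap_le le_rfl hlb hbθ hθr'.le hmax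
    have hφ : ∀ t ∈ Finset.Ioc l (θ (p + 1)), x t = level f' f₀ p + z t := fun t ht => by
      rw [Finset.mem_Ioc] at ht
      exact h.data_eq_level (by omega) (by omega) ht.2
    rw [contrast_const_add hlb.le hbθ.le
      (fun t ht => hφ t (Finset.Ioc_subset_Ioc_right hbθ.le ht))
      (fun t ht => hφ t (Finset.Ioc_subset_Ioc_left hlb.le ht)), sub_self, mul_zero,
      zero_add] at hgap
    have hT : |contrast z l b (θ (p + 1))| ≤ 3 * H * (((θ (p + 1) : ℝ) - b) *
        (((b : ℝ) - l) + ((θ (p + 1) : ℝ) - b))) := by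
      refine (abs_sub _ _).trans ?_
      rw [abs_mul, abs_mul, abs_of_pos (sub_pos.2 hbθ'), abs_of_pos (sub_pos.2 hlb')]
      have k1 := mul_le_mul_of_nonneg_left s3 (sub_pos.2 hbθ').le
      have k2 := mul_le_mul_of_nonneg_left s1 (sub_pos.2 hlb').le
      have hH0 : 0 ≤ H := nonneg_of_mul_nonneg_left ((abs_nonneg _).trans s1) (sub_pos.2 hbθ')
      have k3 : 0 ≤ H * (((θ (p + 1) : ℝ) - b) * (((b : ℝ) - l) + ((θ (p + 1) : ℝ) - b))) :=
        mul_nonneg hH0 (mul_nonneg (by linarith) (by linarith))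
      linarith
    refine key _ _ _ (sub_pos.2 hbθ') hm.1 hT ?_
    rw [show ((b : ℝ) - l) + ((θ (p + 1) : ℝ) - b) = θ (p + 1) - l by ring]
    exact hgap.trans (mul_le_mul_of_nonneg_right hK (abs_nonneg _))
  · rcases hbθ.eq_or_lt with hbθ | hbθ
    · rw [← hbθ, sub_self, abs_zero] at hcon
      exact absurd hκ (not_le.2 hcon)
    have hbθ' : (θ (p + 1) : ℝ) < b := by exact_mod_cast hbθ
    rw [abs_of_pos (sub_pos.2 hbθ')] at hcon
    have s1 := hright (b - θ (p + 1)) (by rw [Nat.cast_sub hbθ.le]; exact hcon.le) (by omega)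
    have s2 := hright (r - θ (p + 1)) (by rw [Nat.cast_sub hθr'.le]; linarith) (by omega)
    rw [Nat.cast_sub hbθ.le, Nat.add_sub_cancel' hbθ.le] at s1
    rw [Nat.cast_sub hθr'.le, Nat.add_sub_cancel' hθr'.le] at s2
    have s3 : |∑ t ∈ Finset.Ioc b r, z t| ≤ H * ((r : ℝ) - θ (p + 1))
        + H * ((b : ℝ) - θ (p + 1)) := by
      rw [← sum_Ioc_add hbθ.le hbr.le] at s2
      have := abs_sub (∑ t ∈ Finset.Ioc (θ (p + 1)) b, z t + ∑ t ∈ Finset.Ioc b r, z t)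
        (∑ t ∈ Finset.Ioc (θ (p + 1)) b, z t)
      rw [add_sub_cancel_left] at this
      linarith
    have hgap := weight_mul_gap_le hlθ'.le hbθ hbr le_rfl hmax
    have hφ : ∀ t ∈ Finset.Ioc (θ (p + 1)) r, x t = level f' f₀ (p + 1) + z t := fun t ht => by
      rw [Finset.mem_Ioc] at ht
      exact h.data_eq_level hjq ht.1 (by omega)
    rw [contrast_const_add hbθ.le hbr.le
      (fun t ht => hφ t (Finset.Ioc_subset_Ioc_right hbr.le ht))
      (fun t ht => hφ t (Finset.Ioc_subset_Ioc_left hbθ.le ht)), sub_self, mul_zero,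
      zero_add] at hgap
    have hT : |contrast z (θ (p + 1)) b r| ≤ 3 * H * (((b : ℝ) - θ (p + 1)) *
        (((r : ℝ) - b) + ((b : ℝ) - θ (p + 1)))) := by
      refine (abs_sub _ _).trans ?_
      rw [abs_mul, abs_mul, abs_of_pos (sub_pos.2 hbθ'), abs_of_pos (sub_pos.2 hbr')]
      have k1 := mul_le_mul_of_nonneg_left s3 (sub_pos.2 hbθ').le
      have k2 := mul_le_mul_of_nonneg_left s1 (sub_pos.2 hbr').le
      have hH0 : 0 ≤ H := nonneg_of_mul_nonneg_left ((abs_nonneg _).trans s1) (sub_pos.2 hbθ')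
      have k3 : 0 ≤ H * (((b : ℝ) - θ (p + 1)) * (((r : ℝ) - b) + ((b : ℝ) - θ (p + 1)))) :=
        mul_nonneg hH0 (mul_nonneg (by linarith) (by linarith))
      linarith
    refine key _ _ _ (sub_pos.2 hbθ') hm.2 hT ?_
    rw [show ((r : ℝ) - b) + ((b : ℝ) - θ (p + 1)) = r - θ (p + 1) by ring,
      mul_comm ((r : ℝ) - b)]
    exact hgap.trans (mul_le_mul_of_nonneg_right hK (abs_nonneg _))

/-- The refined estimates exist, and attain the local rate. -/
lemma Regime.refined (h : Regime c q n θ f' f₀ x z ζ) (hcn5 : 5 ≤ c * n) (hR : 1 ≤ R) {a E : ℝ}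
    (ha : 0 ≤ a) (hE : 24 < c * tol c q * E)
    (hleft : ∀ j ∈ Finset.Icc 1 q, ∀ k : ℕ, (f' j ^ 2)⁻¹ * a ≤ k → k ≤ θ j - θ (j - 1) →
      |∑ t ∈ Finset.Ioc (θ j - k) (θ j), z t| ≤ |f' j| / E * k)
    (hright : ∀ j ∈ Finset.Icc 1 q, ∀ k : ℕ, (f' j ^ 2)⁻¹ * a ≤ k → k ≤ θ (j + 1) - θ j →
      |∑ t ∈ Finset.Ioc (θ j) (θ j + k), z t| ≤ |f' j| / E * k) :
    (∃ θcheck, IsRefinedEstimate x q n R θcheck) ∧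
      ∀ θcheck, IsRefinedEstimate x q n R θcheck →
        ∀ j ∈ Finset.Icc 1 q, f' j ^ 2 * |(θcheck j : ℝ) - θ j| ≤ a := by
  constructor
  · obtain ⟨P, hP⟩ := exists_isWBS2 x hR 0 n
    obtain ⟨path, hpath⟩ := exists_isSolutionPath x P
    obtain ⟨b, hb, htop⟩ := h.exists_top_entries hR hP hpath
    have hex : ∀ j, ∃ m, j ∈ Finset.Icc 1 q →
        IsCusumArgmax x (refineLeft b j) (refineRight q n b j) m := by
      intro j
      by_cases hj : j ∈ Finset.Icc 1 q
      · have h1 := (h.refineLeft_bounds hb hj).2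
        have h2 := (h.refineRight_bounds hcn5 hb hj).2
        have h3 : refineLeft b j < θ j := by
          exact_mod_cast show (refineLeft b j : ℝ) < θ j by linarith
        have h4 : θ j < refineRight q n b j := by
          exact_mod_cast show (θ j : ℝ) < refineRight q n b j by linarith
        obtain ⟨m, hm⟩ := exists_isCusumArgmax x (show refineLeft b j + 1 < refineRight q n b j by omega)
        exact ⟨m, fun _ => hm⟩
      · exact ⟨0, fun hj' => absurd hj' hj⟩
    choose m hm using hex
    exact ⟨m, P, path, b, hP, hpath, htop, hm⟩
  · rintro θcheck ⟨P, path, θhat, hP, hpath, htop, hmax⟩ j hj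
    have hnear := h.near_of_isTopEstimate hR hP hpath htop
    obtain ⟨l1, l2⟩ := h.refineLeft_bounds hnear hj
    obtain ⟨r1, r2⟩ := h.refineRight_bounds hcn5 hnear hj
    have hf : 0 < |f' j| := abs_pos.2 (h.model.jump_ne _ hj)
    have hf2 : 0 < f' j ^ 2 := by rw [← sq_abs]; positivity
    have hE0 : 0 < E := by
      have := mul_pos h.c_pos (tol_pos h.c_pos h.q_pos)
      exact pos_of_mul_pos_right (lt_trans (by norm_num) hE) this.le
    have := h.abs_argmax_sub_le hj l1 r1 l2 r2 (hmax j hj) (by positivity) (H := |f' j| / E) ?_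
      (hleft j hj) (hright j hj)
    · have := mul_le_mul_of_nonneg_left this hf2.le
      rwa [mul_inv_cancel_left₀ hf2.ne'] at this
    · rw [← mul_div_assoc, div_lt_iff₀ hE0]
      have := mul_lt_mul_of_pos_right hE hf
      linarith

end Deterministic

/-! ### The asymptotic statement -/

lemma spacing_le {q n : ℕ} {θ : ℕ → ℕ} {f' : ℕ → ℝ} (h : IsChangePointModel q n θ f') {j : ℕ}
    (hj : j ∈ Finset.Icc 1 q) : spacing θ j ≤ n := by
  rw [Finset.mem_Icc] at hj
  have h1 : (θ j : ℝ) ≤ n := by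
    have := h.mono (show j ≤ q + 1 by omega) le_rfl
    rw [h.last] at this
    exact_mod_cast this
  have h2 : (0 : ℝ) ≤ θ (j - 1) := Nat.cast_nonneg _
  exact (min_le_left _ _).trans (by linarith)

/-- The polynomial rate in the signal strength beats any constant A. -/
lemma ChangePointAssumption.eventually_snr {q : ℕ} {θ : ℕ → ℕ → ℕ} {f' : ℕ → ℕ → ℝ} {ζ : ℕ → ℝ}
    (h : ChangePointAssumption q θ f' ζ) {A : ℝ} (hA : 0 ≤ A) :
    ∀ᶠ n in atTop, ∀ j ∈ Finset.Icc 1 q, A * ζ n ^ 2 ≤ f' n j ^ 2 * spacing (θ n) j := by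
  obtain ⟨c, hc, -, hsp⟩ := h.spacing_ge
  obtain ⟨φ, hφ, C, hC⟩ := h.signal_strength
  have hlim : Tendsto (fun n : ℕ => A * (C * (n : ℝ) ^ (-φ))) atTop (𝓝 0) := by
    have := ((tendsto_rpow_neg_atTop hφ).comp tendsto_natCast_atTop_atTop).const_mul (A * C)
    rw [mul_zero] at this
    exact this.congr fun n => by simp only [Function.comp]; ring
  filter_upwards [h.model, hsp, hC, hlim.eventually (gt_mem_nhds one_pos), eventually_gt_atTop 0]
    with n hm hsp hC hlt hn j hj
  have hn' : (0 : ℝ) < n := by exact_mod_cast hn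
  have hpos : 0 < f' n j ^ 2 * spacing (θ n) j :=
    mul_pos (pow_pos (abs_pos.2 (hm.jump_ne j hj)) 2 |>.trans_eq (sq_abs _))
      ((mul_pos hc hn').trans_le (hsp j hj))
  have h1 := mul_le_mul_of_nonneg_left (hC j hj) hA
  rw [← mul_div_assoc] at h1
  have h2 := h1.trans hlt.le
  rwa [div_le_one hpos] at h2

lemma measurableSet_noiseEvent {Ω : Type*} [MeasurableSpace Ω] {n : ℕ} {Z : ℕ → Ω → ℝ}
    (hZ : ∀ t ∈ Finset.Icc 1 n, Measurable (Z t)) (ζ : ℝ) : MeasurableSet (noiseEvent n Z ζ) := by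
  simp only [noiseEvent, Set.ofPred_forall]
  refine MeasurableSet.iInter fun s => MeasurableSet.iInter fun e => MeasurableSet.iInter fun _ =>
    MeasurableSet.iInter fun hen => measurableSet_le ?_ measurable_const
  refine Measurable.div_const (measurable_norm.comp (Finset.measurable_fun_sum _ fun t ht => hZ t ?_)) _
  rw [Finset.mem_Ioc] at ht
  rw [Finset.mem_Icc]
  omega

/-- Subadditivity bounds the intersection below by μ(B) - μ(Aᶜ), so measurability is required of A
alone. -/
lemma tendsto_measure_inter_one {Ω : Type*} [MeasurableSpace Ω] {μ : Measure Ω}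
    [IsProbabilityMeasure μ] {A B : ℕ → Set Ω} (hA : ∀ n, MeasurableSet (A n))
    (hA1 : Tendsto (fun n => μ (A n)) atTop (𝓝 1)) (hB1 : Tendsto (fun n => μ (B n)) atTop (𝓝 1)) :
    Tendsto (fun n => μ (A n ∩ B n)) atTop (𝓝 1) := by
  have hAc : Tendsto (fun n => μ (A n)ᶜ) atTop (𝓝 0) := by
    have := ENNReal.Tendsto.sub (tendsto_const_nhds (x := (1 : ENNReal))) hA1
      (Or.inl ENNReal.one_ne_top)
    rw [tsub_self] at this
    exact this.congr fun n => (prob_compl_eq_one_sub (hA n)).symm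
  have hlow := ENNReal.Tendsto.sub hB1 hAc (Or.inl ENNReal.one_ne_top)
  rw [tsub_zero] at hlow
  refine tendsto_of_tendsto_of_tendsto_of_le_of_le hlow tendsto_const_nhds (fun n => ?_)
    fun n => prob_le_one
  rw [tsub_le_iff_right]
  refine (measure_mono fun ω hω => ?_).trans (measure_union_le _ _)
  by_cases h : ω ∈ A n
  · exact Or.inl ⟨h, hω⟩
  · exact Or.inr h

/-- Rewriting a normalised bound on a partial sum of the noise. -/
lemma abs_le_of_sqrt_div_mul_le {g E ξ k S : ℝ} (hg : g ≠ 0) (hE : 0 < E) (hξ : 0 < ξ)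
    (hk : (g ^ 2)⁻¹ * (E ^ 2 * ξ ^ 2) ≤ k)
    (h : Real.sqrt ((g ^ 2)⁻¹ * (E ^ 2 * ξ ^ 2)) / k * S ≤ ξ) : S ≤ |g| / E * k := by
  have hg' : 0 < |g| := abs_pos.2 hg
  have hk0 : 0 < k := lt_of_lt_of_le (by positivity) hk
  -- With a = E²ξ² the rate ξ cancels, and the averages are bounded by |g|/E, a small fraction of
  -- the jump.
  have hs : Real.sqrt ((g ^ 2)⁻¹ * (E ^ 2 * ξ ^ 2)) = E * ξ / |g| := by
    rw [show (g ^ 2)⁻¹ * (E ^ 2 * ξ ^ 2) = (E * ξ / |g|) ^ 2 by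
      rw [div_pow, sq_abs, mul_pow]; ring]
    exact Real.sqrt_sq (by positivity)
  rw [hs] at h
  refine le_of_mul_le_mul_left (a := E * ξ / |g| / k) ?_ (by positivity)
  refine h.trans_eq ?_
  field_simp

end WBS

theorem propositionB1 {Ω : Type*} [MeasurableSpace Ω] (μ : Measure Ω) [IsProbabilityMeasure μ]
    (q : ℕ) (hq : 1 ≤ q)
    (θ : ℕ → ℕ → ℕ) (f' : ℕ → ℕ → ℝ) (f₀ : ℕ → ℝ)
    (Z X : ℕ → ℕ → Ω → ℝ)
    (hX : ∀ n, ∀ t ∈ Finset.Icc 1 n, ∀ ω,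
      X n t ω = WBS.signal q (θ n) (f' n) (f₀ n) t + Z n t ω)
    (ζ ζ' : ℕ → ℝ) (R Q : ℕ → ℕ)
    (hZ : WBS.NoiseAssumption μ Z ζ)
    (hθ : WBS.ChangePointAssumption q θ f' ζ)
    (hR : ∀ᶠ n : ℕ in atTop, ∀ j ∈ Finset.Icc 1 q,
      (9 / 8 : ℝ) * ((n : ℝ) / WBS.spacing (θ n) j) ^ 2 + 1 ≤ (R n : ℝ))
    (hQq : ∀ᶠ n : ℕ in atTop, q < Q n)
    (hQ : Tendsto (fun n : ℕ => (Q n : ℝ) * Real.log (ζ n) ^ 2 / Real.log n ^ 2) atTop (𝓝 0))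
    (hloc : WBS.LocalNoiseAssumption μ q θ f' Z ζ ζ') :
    ∃ c₃ : ℝ, 0 < c₃ ∧
      WBS.IsAdmissibleScale q θ f' (fun n => c₃ * ζ' n ^ 2) ∧
      (∀ᶠ n in atTop,
        μ (WBS.noiseEvent n (Z n) (ζ n) ∩
            WBS.localNoiseEvent q (θ n) (f' n) (Z n) (c₃ * ζ' n ^ 2) (ζ' n))
          ≤ μ (WBS.refinedEvent q n (R n) (θ n) (f' n) (X n) (c₃ * ζ' n ^ 2))) ∧
      Tendsto (fun n => μ (WBS.noiseEvent n (Z n) (ζ n) ∩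
            WBS.localNoiseEvent q (θ n) (f' n) (Z n) (c₃ * ζ' n ^ 2) (ζ' n))) atTop (𝓝 1) := by
  obtain ⟨c, hc, hc1, hsp⟩ := hθ.spacing_ge
  obtain ⟨D, hD, hlow⟩ := hloc.rate_lower.exists_pos
  obtain ⟨D', hD', hup⟩ := hloc.rate_upper.exists_pos
  have hlow := hlow.bound
  have hup := hup.bound
  simp only [norm_one, Real.norm_eq_abs] at hlow hup
  have hct : 0 < c * WBS.tol c q := mul_pos hc (WBS.tol_pos hc hq)
  -- The summand D makes E²ζ'² at least 1, as admissibility demands. The other one pushes c·`tol`·E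
  -- above the 24 needed in the refinement. The final constant is c₃ = E².
  set E := D + 25 / (c * WBS.tol c q) with hE
  have hE0 : 0 < E := by positivity
  have hE24 : 24 < c * WBS.tol c q * E := by
    have : c * WBS.tol c q * E = c * WBS.tol c q * D + 25 := by
      rw [hE, mul_add, mul_div_cancel₀ _ hct.ne']
    have := mul_pos hct hD
    linarith
  have hadm : WBS.IsAdmissibleScale q θ f' (fun n => E ^ 2 * ζ' n ^ 2) := by
    filter_upwards [hlow, hup, hθ.eventually_snr (A := E ^ 2 * D' ^ 2) (by positivity)]
      with n h1 h2 h3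
    constructor
    · have hDE : D ≤ E := by
        rw [hE]
        exact le_add_of_nonneg_right (by positivity)
      have : 1 ≤ E * |ζ' n| := h1.trans (mul_le_mul_of_nonneg_right hDE (abs_nonneg _))
      rw [← sq_abs (ζ' n), ← mul_pow]
      exact one_le_pow₀ this
    · intro j hj
      refine le_trans ?_ (h3 j hj)
      rw [mul_assoc]
      refine mul_le_mul_of_nonneg_left ?_ (by positivity)
      have := pow_le_pow_left₀ (abs_nonneg _) h2 2
      rwa [mul_pow, sq_abs, sq_abs] at this
  refine ⟨E ^ 2, by positivity, hadm, ?_, WBS.tendsto_measure_inter_one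
    (fun n => WBS.measurableSet_noiseEvent (hZ.measurable n) _) hZ.prob (hloc.prob _ hadm)⟩
  have h1q : 1 ∈ Finset.Icc 1 q := Finset.mem_Icc.2 ⟨le_rfl, hq⟩
  have hlarge : ∀ᶠ n : ℕ in atTop, 5 ≤ c * (n : ℝ) :=
    (tendsto_natCast_atTop_atTop.const_mul_atTop hc).eventually_ge_atTop 5
  filter_upwards [hadm, hlow, hθ.model, hsp, hR, hlarge, eventually_gt_atTop 0,
    hθ.eventually_snr (A := WBS.snrConst c q ^ 2) (by positivity)]
    with n hadm hlow hmod hsp hR hlarge hn hsnr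
  refine measure_mono fun ω hω => ?_
  obtain ⟨hnoise, hl, hr⟩ := hω
  simp only [Set.mem_ofPred_eq] at hl hr
  have hζ : 0 ≤ ζ n := le_trans (by positivity) (hnoise 0 1 one_pos hn)
  -- The rate assumption controls only |ζ'|. The sign comes from the local event at j = 1 with k the
  -- full distance to the preceding change point, which is long enough by admissibility.
  have hζ' : 0 < ζ' n := by
    have hne : ζ' n ≠ 0 := by
      intro h0
      rw [h0, abs_zero, mul_zero] at hlow
      linarith
    refine lt_of_le_of_ne (le_trans (by positivity) (hl 1 h1q (θ n 1 - θ n (1 - 1)) ?_ le_rfl))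
      hne.symm
    have hf2 : 0 < f' n 1 ^ 2 := by
      have := hmod.jump_ne 1 h1q
      positivity
    have h2 := hmod.mono (show 1 - 1 ≤ 1 by omega) (by omega)
    rw [Nat.cast_sub h2, inv_mul_le_iff₀ hf2]
    exact (hadm.2 1 h1q).trans (mul_le_mul_of_nonneg_left (min_le_left _ _) hf2.le)
  have hreg : WBS.Regime c q n (θ n) (f' n) (f₀ n) (fun t => X n t ω) (fun t => Z n t ω) (ζ n) :=
    { q_pos := hq
      c_pos := hc
      c_lt := hc1
      model := hmod
      data := fun t ht => hX n t ht ω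
      noise := fun s e hse hen => by
        have hse' : (s : ℝ) < e := by exact_mod_cast hse
        exact (div_le_iff₀ (Real.sqrt_pos.2 (sub_pos.2 hse'))).1 (hnoise s e hse hen)
      level_nonneg := hζ
      -- The first gap is bounded through the left half of the first spacing, every other gap
      -- through the right half of the k-th.
      gap_succ := fun k hk => by
        rcases Nat.eq_zero_or_pos k with rfl | hk0
        · exact (hsp 1 h1q).trans (min_le_left _ _)
        · exact (hsp k (Finset.mem_Icc.2 ⟨hk0, hk⟩)).trans (min_le_right _ _)
      snr := fun j hj => by
        refine le_of_sq_le_sq ?_ (by positivity)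
        rw [mul_pow, mul_pow, sq_abs, Real.sq_sqrt (Nat.cast_nonneg n)]
        exact (hsnr j hj).trans
          (mul_le_mul_of_nonneg_left (WBS.spacing_le hmod hj) (sq_nonneg _)) }
  have hRn : 1 ≤ R n := by
    have := hR 1 h1q
    have h0 : 0 ≤ (9 / 8 : ℝ) * ((n : ℝ) / WBS.spacing (θ n) 1) ^ 2 := by positivity
    exact_mod_cast show (1 : ℝ) ≤ R n by linarith
  exact hreg.refined hlarge hRn (by positivity) hE24
    (fun j hj k hk hk' => WBS.abs_le_of_sqrt_div_mul_le (hmod.jump_ne j hj) hE0 hζ' hk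
      (hl j hj k hk hk'))
    (fun j hj k hk hk' => WBS.abs_le_of_sqrt_div_mul_le (hmod.jump_ne j hj) hE0 hζ' hk
      (hr j hj k hk hk'))
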